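/- Let $d\ge 3$ and let $\mathbb H^d=\{x\in\mathbb R^{d+1}: (x^0)^2-\sum_{j=1}^d (x^j)^2=1,\ x^0>0\}$ be hyperbolic space, with the Riemannian metric induced by the Minkowski metric $\mathrm{diag}(1,\dots,1,-1)$ (in the coordinates $(x^1,\dots,x^d,x^0)$), its Riemannian volume $\mu$, gradient $\nabla$ and Laplace–Beltrami operator $\Delta$, the latter regarded as the nonpositive self-adjoint operator on $L^2(\mathbb H^d)$ associated with the Dirichlet form $\int|\nabla f|^2\,d\mu$. Let $H^1(\mathbb H^d)\subset L^2(\mathbb H^d)$ be the completion of $C_0^\infty(\mathbb H^d)$ for the norm $(\|f\|_{L^2}^2+\|\nabla f\|_{L^2}^2)^{1/2}$ (equivalent on $\mathbb H^d$ to $\|\nabla f\|_{L^2}$). For $\lambda>0$ let $$P_\lambda:=2\lambda^{-4}\Delta^2e^{\lambda^{-2}\Delta},$$ where $e^{s\Delta}$, $s>0$, is the heat semigroup on $L^2(\mathbb H^d)$. Then there is a constant $C>0$, depending only on $d$, such that for every (real- or complex-valued) $f\in H^1(\mathbb H^d)$, $$\|f\|_{L^{\frac{2d}{d-2}}(\mathbb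 H^d)}\le C\,\|\nabla f\|_{L^2(\mathbb H^d)}^{\frac{d-2}{d}}\Big(\sup_{\lambda\ge1}\ \lambda^{-\frac{d-2}{2}}\,\|P_\lambda f\|_{L^\infty(\mathbb H^d)}\Big)^{\frac2d}.$$ (Since $P_\lambda f$ is continuous, $\|P_\lambda f\|_{L^\infty}=\sup_{x\in\mathbb H^d}|P_\lambda f(x)|$.) -/

import Mathlib

open MeasureTheory
open scoped ENNReal ContDiff

noncomputable section

namespace HypSpace

/-- The space `ℝ^d` of spatial variables `(x¹, …, x^d)`. -/
abbrev E (d : ℕ) : Type := EuclideanSpace ℝ (Fin d)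

/-- The Lorentz form `[x, y] = x⁰ y⁰ - ∑ⱼ xʲ yʲ` on `ℝ^{d+1}`. A point of `ℝ^{d+1}` is a pair
consisting of the spatial part `(x¹, …, x^d)` and the time coordinate `x⁰`. -/
def lorentz {d : ℕ} (x y : E d × ℝ) : ℝ := x.2 * y.2 - ∑ j, x.1 j * y.1 j

/-- Hyperbolic space `ℍ^d = {x ∈ ℝ^{d+1} : [x, x] = 1, x⁰ > 0}`. -/
abbrev Hyp (d : ℕ) : Type := {x : E d × ℝ // lorentz x x = 1 ∧ 0 < x.2}

/-- The Japanese bracket `⟨x⟩ = (1 + |x|²)^{1/2}`. -/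
def bracket {d : ℕ} (x : E d) : ℝ := √(1 + ‖x‖ ^ 2)

/-- The global parametrization `x ↦ (x, ⟨x⟩)` of the hyperboloid, with values in `ℝ^{d+1}`. -/
def graphMap {d : ℕ} (x : E d) : E d × ℝ := (x, bracket x)

theorem graphMap_mem {d : ℕ} (x : E d) :
    lorentz (graphMap x) (graphMap x) = 1 ∧ 0 < (graphMap x).2 := by
  have h : 0 < 1 + ‖x‖ ^ 2 := by positivity
  refine ⟨?_, Real.sqrt_pos.2 h⟩
  have h' : bracket x * bracket x = 1 + ‖x‖ ^ 2 := Real.mul_self_sqrt h.le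
  simp only [lorentz, graphMap, h', EuclideanSpace.real_norm_sq_eq]
  simp only [← pow_two]
  ring

/-- The global chart of `ℍ^d`, as a map from `ℝ^d` onto `ℍ^d`. -/
def param {d : ℕ} (x : E d) : Hyp d := ⟨graphMap x, graphMap_mem x⟩

/-- The Riemannian metric of `ℍ^d` in the global chart: the pull-back under `x ↦ (x, ⟨x⟩)` of the
Minkowski metric `diag(1, …, 1, -1)`, which is minus the Lorentz form. -/
def metric {d : ℕ} (x : E d) : Matrix (Fin d) (Fin d) ℝ :=
  Matrix.of fun i j =>
    -lorentz (fderiv ℝ graphMap x (EuclideanSpace.single i 1))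
      (fderiv ℝ graphMap x (EuclideanSpace.single j 1))

/-- The Riemannian volume `μ` of `ℍ^d`: `√(det g) dx` in the global chart. -/
def vol (d : ℕ) : Measure (Hyp d) :=
  ((volume : Measure (E d)).withDensity fun x => ENNReal.ofReal √(metric x).det).map param

/-- The global frame `eᵢ = ∂ᵢ + xⁱ / (1 + ⟨x⟩) ∑ⱼ xʲ ∂ⱼ` of `ℍ^d`, in the global chart. It is
orthonormal for the Riemannian metric, see `frame_orthonormal` below. -/
def frame {d : ℕ} (x : E d) (i : Fin d) : E d :=
  EuclideanSpace.single i 1 + (x i / (1 + bracket x)) • x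

/-- Smooth compactly supported functions on `ℍ^d`, i.e. the class `C₀^∞(ℍ^d)`. -/
structure IsTestFunction {d : ℕ} (φ : Hyp d → ℂ) : Prop where
  smooth : ContDiff ℝ ∞ (φ ∘ param)
  compactSupport : HasCompactSupport (φ ∘ param)

/-- The spatial part in `ℝ^d` of a point of the hyperboloid, i.e. its coordinates in the
global chart. -/
def coord {d : ℕ} (p : Hyp d) : E d := p.1.1

/-- The Riemannian gradient of `φ`, through its components `(e₁ φ, …, e_d φ)` in the global
orthonormal frame. -/
def grad {d : ℕ} (φ : Hyp d → ℂ) (p : Hyp d) : EuclideanSpace ℂ (Fin d) :=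
  WithLp.toLp 2 fun i => fderiv ℝ (φ ∘ param) (coord p) (frame (coord p) i)

/-- `L²(ℍ^d)`. -/
abbrev L2 (d : ℕ) : Type := Lp ℂ 2 (vol d)

/-- Square integrable vector fields on `ℍ^d`, through their components in the global orthonormal
frame. -/
abbrev L2Field (d : ℕ) : Type := Lp (EuclideanSpace ℂ (Fin d)) 2 (vol d)

/-- The Hilbert space `L²(ℍ^d) × L²(ℍ^d; Tℍ^d)`, with norm `(‖f‖² + ‖X‖²)^{1/2}`. -/
abbrev Pairs (d : ℕ) : Type := WithLp 2 (L2 d × L2Field d)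

/-- The pairs `(φ, ∇φ)` with `φ ∈ C₀^∞(ℍ^d)`. -/
def testGraph (d : ℕ) : Submodule ℂ (Pairs d) where
  carrier := {U | ∃ φ : Hyp d → ℂ, IsTestFunction φ ∧ U.fst =ᵐ[vol d] φ ∧ U.snd =ᵐ[vol d] grad φ}
  zero_mem' := by
    refine ⟨0, ⟨contDiff_const, HasCompactSupport.zero⟩, Lp.coeFn_zero _ _ _, ?_⟩
    refine (Lp.coeFn_zero _ _ _).trans (Filter.EventuallyEq.of_eq ?_)
    funext p
    ext i
    have h : ((0 : Hyp d → ℂ) ∘ param) = fun _ => (0 : ℂ) := rfl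
    simp [grad, h]
  add_mem' := by
    rintro U V ⟨φ, hφ, hU, hU'⟩ ⟨ψ, hψ, hV, hV'⟩
    refine ⟨φ + ψ, ⟨hφ.smooth.add hψ.smooth, hφ.compactSupport.add hψ.compactSupport⟩,
      (Lp.coeFn_add _ _).trans (hU.add hV), (Lp.coeFn_add _ _).trans ((hU'.add hV').trans
        (Filter.EventuallyEq.of_eq ?_))⟩
    funext p
    ext i
    have h : (φ + ψ) ∘ param = φ ∘ param + ψ ∘ param := rfl
    have h1 := hφ.smooth.differentiable (by simp) (coord p)
    have h2 := hψ.smooth.differentiable (by simp) (coord p)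
    simp [grad, h, fderiv_add h1 h2]
  smul_mem' := by
    rintro c U ⟨φ, hφ, hU, hU'⟩
    refine ⟨c • φ, ⟨contDiff_const.smul hφ.smooth, hφ.compactSupport.smul_left (f := fun _ => c)⟩,
      (Lp.coeFn_smul _ _).trans (hU.const_smul c), (Lp.coeFn_smul _ _).trans
        ((hU'.const_smul c).trans (Filter.EventuallyEq.of_eq ?_))⟩
    funext p
    ext i
    have h : (c • φ) ∘ param = c • (φ ∘ param) := rfl
    have h1 := hφ.smooth.differentiable (by simp) (coord p)
    simp [grad, h, fderiv_const_smul h1]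

/-- The Sobolev space `H¹(ℍ^d)`, the completion of `C₀^∞(ℍ^d)`, realized as the closure of the
set of the pairs `(φ, ∇φ)`: its elements are the pairs `(f, ∇f)` with `f ∈ H¹(ℍ^d)`. -/
abbrev H1 (d : ℕ) : Submodule ℂ (Pairs d) := (testGraph d).topologicalClosure

/-- `f ∈ H¹(ℍ^d)` and its gradient is the square integrable vector field `X`. -/
def HasGradient {d : ℕ} (f : L2 d) (X : L2Field d) : Prop :=
  (WithLp.toLp 2 (f, X) : Pairs d) ∈ H1 d

/-- The inclusion `J : H¹(ℍ^d) → L²(ℍ^d)`. -/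
def inclusion (d : ℕ) : H1 d →L[ℂ] L2 d :=
  (WithLp.fstL 2 ℂ (L2 d) (L2Field d)).comp (H1 d).subtypeL

/-- The resolvent `(1 - Δ)⁻¹ = J J*` of the Laplace-Beltrami operator `Δ` of `ℍ^d`:
`u = J J* f` is the element of `H¹(ℍ^d)` such that `⟨u, v⟩ + ⟨∇u, ∇v⟩ = ⟨f, v⟩` for all
`v ∈ H¹(ℍ^d)`, which is the weak form of `u - Δ u = f`
(see `resolvent_mem` and `resolvent_weak_equation`). -/
def resolvent (d : ℕ) : L2 d →L[ℂ] L2 d :=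
  (inclusion d).comp (inclusion d).adjoint

/-- For a bounded self-adjoint operator `R` of the form `R = (1 - A)⁻¹`, `A ≤ 0` self-adjoint on a
complex Hilbert space, the operator `m(A)` of the functional calculus of `A`, for a function `m` that
is continuous on `(-∞, 0]` and tends to `0` at `-∞`. Since `A = 1 - R⁻¹`, it is the function
`t ↦ m (1 - t⁻¹)`, continued by `0`, of `R`, whose spectrum lies in `[0, 1]`. -/
def functionOfGenerator {H : Type*} [NormedAddCommGroup H] [InnerProductSpace ℂ H]
    [CompleteSpace H] (R : H →L[ℂ] H) (m : ℝ → ℝ) : H →L[ℂ] H :=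
  cfc (fun t : ℝ => if 0 < t then m (1 - t⁻¹) else 0) R

/-- The operator `m(Δ)` on `L²(ℍ^d)` given by the functional calculus of the self-adjoint operator
`Δ ≤ 0`. -/
def functionOfLaplacian (d : ℕ) (m : ℝ → ℝ) : L2 d →L[ℂ] L2 d :=
  functionOfGenerator (resolvent d) m

/-- The heat semigroup `e^{sΔ}`, `s > 0`. -/
def heatSemigroup (d : ℕ) (s : ℝ) : L2 d →L[ℂ] L2 d :=
  functionOfLaplacian d fun z => Real.exp (s * z)

/-- The Littlewood-Paley projection `P_l = 2 l⁻⁴ Δ² e^{l⁻² Δ}`, `l > 0`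
(see also `littlewoodPaley_spec`). -/
def littlewoodPaley (d : ℕ) (l : ℝ) : L2 d →L[ℂ] L2 d :=
  functionOfLaplacian d fun z => 2 * (l ^ 4)⁻¹ * z ^ 2 * Real.exp ((l ^ 2)⁻¹ * z)

theorem hasFDerivAt_bracket {d : ℕ} (x : E d) :
    HasFDerivAt (bracket (d := d)) ((bracket x)⁻¹ • innerSL ℝ x) x := by
  have h : (1 + ‖x‖ ^ 2) ≠ 0 := by positivity
  have := ((hasStrictFDerivAt_norm_sq x).hasFDerivAt.const_add 1).sqrt h
  refine this.congr_fderiv ?_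
  ext v
  simp [bracket]
  field_simp

theorem metric_apply {d : ℕ} (x : E d) (i j : Fin d) :
    metric x i j = (if i = j then 1 else 0) - x i * x j / (1 + ‖x‖ ^ 2) := by
  have h : HasFDerivAt (graphMap (d := d))
      ((ContinuousLinearMap.id ℝ (E d)).prod ((bracket x)⁻¹ • innerSL ℝ x)) x :=
    (hasFDerivAt_id x).prodMk (hasFDerivAt_bracket x)
  have hb : bracket x * bracket x = 1 + ‖x‖ ^ 2 := Real.mul_self_sqrt (by positivity)
  have h0 : bracket x ≠ 0 := (graphMap_mem x).2.ne'
  simp [metric, h.fderiv, lorentz, EuclideanSpace.inner_single_right, ← hb]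
  by_cases hij : i = j
  · simp [hij]; field_simp
  · simp [hij, Ne.symm hij]; field_simp

/-- The frame `e₁, …, e_d` is orthonormal for the Riemannian metric. -/
theorem frame_orthonormal {d : ℕ} (x : E d) (i j : Fin d) :
    ∑ k, ∑ l, metric x k l * frame x i k * frame x j l = if i = j then 1 else 0 := by
  have hb : bracket x ^ 2 = 1 + ‖x‖ ^ 2 := Real.sq_sqrt (by positivity)
  have h0 : 0 < bracket x := (graphMap_mem x).2
  have hn : ∑ k, x k * x k = bracket x ^ 2 - 1 := by
    rw [hb, EuclideanSpace.real_norm_sq_eq]; simp [← pow_two]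
  have hs : ∀ i, ∑ k, x k * frame x i k = bracket x * x i := by
    intro i
    simp [frame, mul_add, Finset.sum_add_distrib, mul_left_comm (x _) (x i / _),
      ← Finset.mul_sum, hn]
    field_simp; ring
  have hf : ∑ k, frame x i k * frame x j k
      = (if i = j then 1 else 0) + x i * x j := by
    simp only [frame, PiLp.add_apply, PiLp.smul_apply, smul_eq_mul]
    simp only [add_mul, mul_add, Finset.sum_add_distrib]
    have h4 : ∑ k, x i / (1 + bracket x) * x k * (x j / (1 + bracket x) * x k)
        = x i / (1 + bracket x) * (x j / (1 + bracket x)) * (bracket x ^ 2 - 1) := by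
      rw [← hn, Finset.mul_sum]; exact Finset.sum_congr rfl fun k _ => by ring
    rw [h4]
    simp
    by_cases hij : i = j
    · simp [hij]; field_simp; ring
    · simp [hij, Ne.symm hij]; field_simp; ring
  have hd : ∀ k l, metric x k l * frame x i k * frame x j l
      = (if k = l then frame x i k * frame x j l else 0)
        - (bracket x ^ 2)⁻¹ * ((x k * frame x i k) * (x l * frame x j l)) := by
    intro k l
    rw [metric_apply, ← hb]
    by_cases hkl : k = l
    · simp [hkl]; ring
    · simp [hkl]; ring
  simp only [hd, Finset.sum_sub_distrib, ← Finset.mul_sum, ← Finset.sum_mul, hs]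
  simp [hf]
  field_simp; ring

theorem resolvent_isSelfAdjoint (d : ℕ) : IsSelfAdjoint (resolvent d) := by
  rw [ContinuousLinearMap.isSelfAdjoint_iff', resolvent, ContinuousLinearMap.adjoint_comp,
    ContinuousLinearMap.adjoint_adjoint]

theorem resolvent_mem (d : ℕ) (f : L2 d) :
    HasGradient (resolvent d f) ((inclusion d).adjoint f).1.snd :=
  ((inclusion d).adjoint f).2

theorem resolvent_weak_equation (d : ℕ) (f v : L2 d) (X : L2Field d) (h : HasGradient v X) :
    inner ℂ (resolvent d f) v + inner ℂ ((inclusion d).adjoint f).1.snd X = inner ℂ f v :=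
  (ContinuousLinearMap.adjoint_inner_left (inclusion d) (⟨_, h⟩ : H1 d) f)

theorem continuous_symbol (c s : ℝ) (hs : 0 < s) (k : ℕ) :
    Continuous fun t : ℝ =>
      if 0 < t then c * (1 - t⁻¹) ^ k * Real.exp (s * (1 - t⁻¹)) else 0 := by
  rw [continuous_iff_continuousAt]
  intro t
  rcases lt_trichotomy t 0 with ht | rfl | ht
  · refine ContinuousAt.congr continuousAt_const (f := fun _ => (0 : ℝ)) ?_
    filter_upwards [gt_mem_nhds ht] with u hu
    simp [hu.le]
  · have h1 : Filter.Tendsto (fun y : ℝ => y ^ k * Real.exp (-s * y)) Filter.atTop (nhds 0) := by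
      simpa using tendsto_rpow_mul_exp_neg_mul_atTop_nhds_zero k s hs
    have h2 : Filter.Tendsto (fun t : ℝ => t⁻¹ - 1) (nhdsWithin 0 (Set.Ioi 0)) Filter.atTop :=
      Filter.tendsto_atTop_add_const_right _ _ tendsto_inv_nhdsGT_zero
    have h3 := ((h1.comp h2).const_mul (c * (-1) ^ k))
    rw [continuousAt_iff_continuous_left'_right']
    constructor
    · refine ContinuousWithinAt.congr (f := fun _ => (0 : ℝ)) continuousWithinAt_const ?_ (by simp)
      intro y hy
      simp [(Set.mem_Iio.1 hy).le]
    · rw [ContinuousWithinAt]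
      simp only [lt_irrefl, if_false]
      refine Filter.Tendsto.congr' ?_ (by simpa using h3)
      filter_upwards [self_mem_nhdsWithin] with y hy
      have e1 : (1 - y⁻¹) = (-1) * (y⁻¹ - 1) := by ring
      have e2 : -(s * (y⁻¹ - 1)) = s * ((-1) * (y⁻¹ - 1)) := by ring
      simp only [if_pos (Set.mem_Ioi.1 hy)]
      rw [e1, mul_pow, ← e2]
      ring
  · have : ContinuousAt (fun t : ℝ => c * (1 - t⁻¹) ^ k * Real.exp (s * (1 - t⁻¹))) t := by
      have := continuousAt_inv₀ ht.ne'
      fun_prop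
    refine this.congr ?_
    filter_upwards [lt_mem_nhds ht] with u hu
    simp [hu]

theorem functionOfGenerator_spec {H : Type*} [NormedAddCommGroup H] [InnerProductSpace ℂ H]
    [CompleteSpace H] (R : H →L[ℂ] H) (hR : IsSelfAdjoint R) (l : ℝ) (hl : 0 < l) :
    R ^ 2 * functionOfGenerator R
        (fun z => 2 * (l ^ 4)⁻¹ * z ^ 2 * Real.exp ((l ^ 2)⁻¹ * z))
      = ((2 * (l ^ 4)⁻¹ : ℝ) : ℂ) • ((R - 1) ^ 2 * functionOfGenerator R
          fun z => Real.exp ((l ^ 2)⁻¹ * z)) := by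
  have hc := continuous_symbol (2 * (l ^ 4)⁻¹) (l ^ 2)⁻¹ (by positivity) 2
  have hc' := continuous_symbol 1 (l ^ 2)⁻¹ (by positivity) 0
  simp only [pow_zero, one_mul] at hc'
  have h1 : R ^ 2 = cfc (fun t : ℝ => t ^ 2) R := (cfc_pow_id R 2).symm
  have h2 : (R - 1) ^ 2 = cfc (fun t : ℝ => (t - 1) ^ 2) R := by
    rw [cfc_pow (fun t : ℝ => t - 1) 2 R, cfc_sub (fun t : ℝ => t) (fun _ => 1) R, cfc_id' ℝ R,
      cfc_const_one ℝ R]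
  have hk : Continuous fun t : ℝ =>
      (t - 1) ^ 2 * if 0 < t then Real.exp ((l ^ 2)⁻¹ * (1 - t⁻¹)) else 0 :=
    (by fun_prop : Continuous fun t : ℝ => (t - 1) ^ 2).mul hc'
  rw [Complex.coe_smul, h1, h2, functionOfGenerator, functionOfGenerator,
    ← cfc_mul _ _ _ (by fun_prop) hc.continuousOn, ← cfc_mul _ _ _ (by fun_prop) hc'.continuousOn,
    ← cfc_smul (2 * (l ^ 4)⁻¹ : ℝ) _ R hk.continuousOn]
  congr 1
  funext t
  by_cases ht : 0 < t
  · simp only [ht, if_true, smul_eq_mul]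
    field_simp
  · simp [ht]

/-- `R² P_l = 2 l⁻⁴ (R - 1)² e^{l⁻² Δ}` with `R = (1 - Δ)⁻¹`. Since `R Δ = R - 1`, this says that
`P_l = 2 l⁻⁴ Δ² e^{l⁻² Δ}`. -/
theorem littlewoodPaley_spec (d : ℕ) (l : ℝ) (hl : 0 < l) :
    resolvent d ^ 2 * littlewoodPaley d l
      = ((2 * (l ^ 4)⁻¹ : ℝ) : ℂ) • ((resolvent d - 1) ^ 2 * heatSemigroup d ((l ^ 2)⁻¹)) :=
  functionOfGenerator_spec _ (resolvent_isSelfAdjoint d) l hl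

end HypSpace

end

noncomputable section

namespace HypSpace

/-! Let `R = (1 - Δ)⁻¹ = J J*`. The Poincaré inequality `‖f‖ ≤ ‖∇f‖` gives `‖J‖² ≤ 1/2`, so the
spectrum of `R` lies in `[0, 1/2]`, that is `-Δ ≥ 1`. With `L_s = (1 - sΔ) e^{sΔ}` one has `-∂_s L_s
= s Δ² e^{sΔ}`, which at `s = λ⁻²` equals `(λ²/2) P_λ`. Bounds on `P_λ f` for `λ ≥ 1` therefore
control the increments of `L_s f` for `s ≤ 1`. Split `f = (f - L_1 f) + L_1 f`, and write `p =
2d/(d-2)`, `β = (d-2)/2`, `A` for a bound of the supremum.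

High frequencies. Put `h = f - L_1 f` and `r_k = f - L_{4^{-k}} f`. Integrating the increments gives
`|h - r_k| ≲ A 2^{βk}` almost everywhere, while the spectral theorem gives the square function bound
`∑ 4^k ‖r_k‖² ≲ ‖f‖²_{H¹}`. At a point where `|h|` is comparable to a large multiple of `A 2^{βk}`,
at least half of `h` comes from `r_k`. Since `β(p-2) = 2`, this yields `|h|^p ≲ A^{p-2} 4^k |r_k|²`,
and one sums over `k` and integrates (`norm_rpow_le_of_decomposition`,
`eLpNorm_le_of_decomposition`, `sum_norm_sub_lowPart_sq_le`).

Low frequencies. Only `λ = 1` enters: with `g = Δ² e^Δ f`, `L_1 f = (1 - Δ) Δ⁻² g = ∑ (n+1) R^{n+1}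
g`. The spectral gap makes `R^n g` decay geometrically in `L²`, and the maximum principle
(`resolvent_mem_box`) keeps it bounded in `L^∞`. Interpolation gives a convergent series of `L^p`
bounds (`exists_eLpNorm_lowSymbol_le`). -/

/-! ### The volume and the frame in the global chart. -/

theorem bracket_pos {d : ℕ} (x : E d) : 0 < bracket x := (graphMap_mem x).2

theorem bracket_sq {d : ℕ} (x : E d) : bracket x ^ 2 = 1 + ‖x‖ ^ 2 :=
  Real.sq_sqrt (by positivity)

theorem contDiff_bracket {d : ℕ} : ContDiff ℝ ∞ (bracket (d := d)) := by
  unfold bracket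
  exact ContDiff.sqrt (contDiff_const.add (contDiff_norm_sq ℝ)) fun x => by positivity

theorem continuous_bracket {d : ℕ} : Continuous (bracket (d := d)) :=
  contDiff_bracket.continuous

/-- The global chart of hyperbolic space, as a homeomorphism. -/
def chart (d : ℕ) : E d ≃ₜ Hyp d where
  toFun := param
  invFun := coord
  left_inv _ := rfl
  right_inv p := by
    obtain ⟨⟨x, t⟩, h, ht⟩ := p
    have h' : t ^ 2 = 1 + ‖x‖ ^ 2 := by
      simp only [lorentz, ← pow_two] at h
      rw [EuclideanSpace.real_norm_sq_eq]
      linarith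
    refine Subtype.ext (Prod.ext rfl ?_)
    change √(1 + ‖x‖ ^ 2) = t
    rw [← h', Real.sqrt_sq (le_of_lt ht)]
  continuous_toFun := Continuous.subtype_mk (continuous_id.prodMk continuous_bracket) _
  continuous_invFun := continuous_fst.comp continuous_subtype_val

/-- The metric is a rank-one perturbation of the identity, so the matrix determinant lemma gives `1
- |x|²/⟨x⟩² = ⟨x⟩⁻²`. -/
theorem det_metric {d : ℕ} (x : E d) : (metric x).det = (bracket x ^ 2)⁻¹ := by
  have h : metric x = 1 + Matrix.replicateCol Unit (fun i => -(x i / bracket x ^ 2)) *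
      Matrix.replicateRow Unit (fun i => x i) := by
    ext i j
    rw [metric_apply, ← bracket_sq]
    simp [Matrix.mul_apply, Matrix.one_apply]
    ring
  rw [h, Matrix.det_one_add_replicateCol_mul_replicateRow]
  have hb := bracket_pos x
  have hn : ∑ i, x i * x i = bracket x ^ 2 - 1 := by
    rw [bracket_sq, EuclideanSpace.real_norm_sq_eq]; simp [← pow_two]
  have : (fun i => x i) ⬝ᵥ (fun i => -(x i / bracket x ^ 2))
      = -((∑ i, x i * x i) / bracket x ^ 2) := by
    simp only [dotProduct, Finset.sum_div, ← Finset.sum_neg_distrib]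
    exact Finset.sum_congr rfl fun i _ => by ring
  rw [this, hn]
  field_simp
  ring

theorem vol_eq (d : ℕ) : vol d =
    ((volume : Measure (E d)).withDensity fun x => ENNReal.ofReal (bracket x)⁻¹).map
      (chart d).toMeasurableEquiv := by
  have : (fun x : E d => ENNReal.ofReal √(metric x).det)
      = fun x => ENNReal.ofReal (bracket x)⁻¹ := by
    funext x
    rw [det_metric, ← inv_pow, Real.sqrt_sq (inv_nonneg.2 (bracket_pos x).le)]
  rw [vol, this]
  rfl

theorem measurable_density {d : ℕ} :
    Measurable fun x : E d => ENNReal.ofReal (bracket x)⁻¹ := by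
  have := (continuous_bracket (d := d)).measurable
  fun_prop

theorem integral_vol {d : ℕ} (F : Hyp d → ℝ) :
    ∫ p, F p ∂vol d = ∫ x, F (param x) / bracket x := by
  rw [vol_eq, integral_map_equiv,
    integral_withDensity_eq_integral_toReal_smul measurable_density (by simp)]
  refine integral_congr_ae (Filter.Eventually.of_forall fun x => ?_)
  simp only [ENNReal.toReal_ofReal (inv_nonneg.2 (bracket_pos x).le), smul_eq_mul]
  rw [div_eq_inv_mul]
  rfl

theorem integrable_vol {d : ℕ} (F : Hyp d → ℝ) :
    Integrable F (vol d) ↔ Integrable fun x => F (param x) / bracket x := by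
  rw [vol_eq, integrable_map_equiv,
    integrable_withDensity_iff measurable_density (by simp)]
  refine integrable_congr (Filter.Eventually.of_forall fun x => ?_)
  simp only [ENNReal.toReal_ofReal (inv_nonneg.2 (bracket_pos x).le)]
  rw [div_eq_mul_inv]
  rfl

theorem continuous_frame {d : ℕ} (i : Fin d) : Continuous fun x : E d => frame x i := by
  unfold frame
  have h : ∀ x : E d, 1 + bracket x ≠ 0 := fun x => by have := bracket_pos x; positivity
  have := continuous_bracket (d := d)
  refine continuous_const.add (Continuous.smul (Continuous.div ?_ (by fun_prop) h) continuous_id)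
  fun_prop

theorem IsTestFunction.continuous {d : ℕ} {φ : Hyp d → ℂ} (hφ : IsTestFunction φ) :
    Continuous φ := by
  have h := hφ.smooth.continuous.comp (chart d).symm.continuous
  have e : (φ ∘ param) ∘ (chart d).symm = φ :=
    funext fun p => congrArg φ ((chart d).apply_symm_apply p)
  rwa [e] at h

theorem IsTestFunction.continuous_grad {d : ℕ} {φ : Hyp d → ℂ} (hφ : IsTestFunction φ) :
    Continuous (grad φ) := by
  unfold grad
  refine (PiLp.continuous_toLp 2 _).comp (continuous_pi fun i => ?_)
  have hc : Continuous (coord (d := d)) := (chart d).symm.continuous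
  exact ((hφ.smooth.continuous_fderiv (by simp)).comp hc).clm_apply
    ((continuous_frame i).comp hc)

/-! ### The Poincaré inequality, from the Euler vector field. -/

/-- Because `|x|² = (⟨x⟩ - 1)(⟨x⟩ + 1)`, one has `∑ xⁱ eᵢ = ⟨x⟩ x`: in the orthonormal frame the
Euler field has components `xⁱ/⟨x⟩`. -/
theorem fderiv_self_eq_sum_frame {d : ℕ} (L : E d →L[ℝ] ℂ) (x : E d) :
    L x = (bracket x)⁻¹ • ∑ i, x i • L (frame x i) := by
  have hb := bracket_pos x
  have hn : ∑ i, x i * x i = bracket x ^ 2 - 1 := by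
    rw [bracket_sq, EuclideanSpace.real_norm_sq_eq]; simp [← pow_two]
  have hx : ∑ i, x i • frame x i = bracket x • x := by
    simp only [frame, smul_add, smul_smul, Finset.sum_add_distrib, ← Finset.sum_smul]
    have h1 : ∑ i, x i • EuclideanSpace.single i (1 : ℝ) = x := by
      ext j
      simp [Finset.sum_apply, Pi.single_apply]
    have h2 : ∑ i, x i * (x i / (1 + bracket x)) = bracket x - 1 := by
      simp only [← mul_div_assoc, ← Finset.sum_div, hn]
      field_simp
      ring
    rw [h1, h2, sub_smul, one_smul]
    abel
  simp only [← map_smul, ← map_sum]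
  rw [hx, smul_smul, inv_mul_cancel₀ hb.ne', one_smul]

/-- The Euler field has Riemannian length `|x|/⟨x⟩ ≤ 1`. A bounded field whose divergence is bounded
below by a positive constant is what produces a Poincaré inequality. -/
theorem norm_fderiv_self_le_grad {d : ℕ} (φ : Hyp d → ℂ) (x : E d) :
    ‖fderiv ℝ (φ ∘ param) x x‖ ≤ ‖grad φ (param x)‖ := by
  have hb := bracket_pos x
  rw [fderiv_self_eq_sum_frame, norm_smul, Real.norm_of_nonneg (inv_nonneg.2 hb.le)]
  have h1 : ‖∑ i, x i • fderiv ℝ (φ ∘ param) x (frame x i)‖ ≤ ‖x‖ * ‖grad φ (param x)‖ := by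
    refine (norm_sum_le _ _).trans (le_of_sq_le_sq ?_ (by positivity))
    rw [mul_pow, EuclideanSpace.real_norm_sq_eq, EuclideanSpace.norm_sq_eq]
    simp only [norm_smul]
    refine (Finset.sum_mul_sq_le_sq_mul_sq _ _ _).trans (le_of_eq ?_)
    simp [grad, coord, param, graphMap]
  have h2 : ‖x‖ ≤ bracket x := by
    refine le_of_sq_le_sq ?_ hb.le
    rw [bracket_sq]; linarith
  calc (bracket x)⁻¹ * _ ≤ (bracket x)⁻¹ * (bracket x * ‖grad φ (param x)‖) := by
        gcongr
        exact h1.trans (by gcongr)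
    _ = _ := by field_simp

/-- The divergence theorem for the Euler vector field. -/
theorem integral_euler_eq_zero {d : ℕ} {F : E d → ℝ} (hF : ContDiff ℝ ∞ F)
    (hc : HasCompactSupport F) : Integrable (fun x => d * F x + fderiv ℝ F x x) ∧
      ∫ x, (d * F x + fderiv ℝ F x x) = 0 := by
  have hF0 : Integrable F := hF.continuous.integrable_of_hasCompactSupport hc
  have hF' := hF.continuous_fderiv (by simp)
  have hi : ∀ i : Fin d, Integrable fun x : E d => x i * fderiv ℝ F x (EuclideanSpace.single i 1) := by
    intro i
    refine Continuous.integrable_of_hasCompactSupport (by fun_prop) ?_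
    exact (hc.fderiv_apply ℝ (EuclideanSpace.single i 1)).mul_left
  have hp : ∀ i : Fin d, ∫ x : E d, x i * fderiv ℝ F x (EuclideanSpace.single i 1) = -∫ x, F x := by
    intro i
    have hl : ∀ x : E d, HasFDerivAt (fun y : E d => y i) (EuclideanSpace.proj i : E d →L[ℝ] ℝ) x :=
      fun x => (EuclideanSpace.proj i : E d →L[ℝ] ℝ).hasFDerivAt
    have h1 : ∀ x : E d, fderiv ℝ (fun y : E d => y i) x (EuclideanSpace.single i 1) = 1 := by
      intro x
      rw [(hl x).fderiv]; simp
    have := integral_mul_fderiv_eq_neg_fderiv_mul_of_integrable (μ := (volume : Measure (E d)))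
      (f := fun x : E d => x i) (g := F) (v := EuclideanSpace.single i 1)
      (by simpa only [h1, one_mul] using hF0) (hi i)
      (Continuous.integrable_of_hasCompactSupport (by have := hF.continuous; fun_prop) hc.mul_left)
      (fun x _ => (hl x).differentiableAt) (fun x _ => hF.differentiable (by simp) x)
    simpa only [h1, one_mul] using this
  have hs : ∀ x : E d, fderiv ℝ F x x = ∑ i, x i * fderiv ℝ F x (EuclideanSpace.single i 1) := by
    intro x
    have h1 : ∑ i, x i • EuclideanSpace.single i (1 : ℝ) = x := by
      ext j
      simp [Finset.sum_apply, Pi.single_apply]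
    have h2 := map_sum (fderiv ℝ F x) (fun i => x i • EuclideanSpace.single i (1 : ℝ)) Finset.univ
    rw [h1] at h2
    simpa only [map_smul, smul_eq_mul] using h2
  simp only [hs]
  have h2 := integrable_finsetSum Finset.univ fun i _ => hi i
  refine ⟨(hF0.const_mul _).add h2, ?_⟩
  rw [integral_add (hF0.const_mul _) h2, integral_const_mul, integral_finsetSum _ fun i _ => hi i]
  simp [hp]

theorem IsTestFunction.integrable_norm_sq {d : ℕ} {φ : Hyp d → ℂ} (hφ : IsTestFunction φ) :
    Integrable (fun p => ‖φ p‖ ^ 2) (vol d) := by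
  rw [integrable_vol]
  have h1 := hφ.smooth.continuous
  refine Continuous.integrable_of_hasCompactSupport
    ((h1.norm.pow 2).div continuous_bracket fun x => (bracket_pos x).ne') ?_
  refine hφ.compactSupport.mono' fun x hx => subset_closure ?_
  intro h
  exact hx (by simp only [Function.comp_apply] at h; simp [h])

theorem IsTestFunction.integrable_grad_sq {d : ℕ} {φ : Hyp d → ℂ} (hφ : IsTestFunction φ) :
    Integrable (fun p => ‖grad φ p‖ ^ 2) (vol d) := by
  rw [integrable_vol]
  have h1 := hφ.continuous_grad.comp (chart d).continuous
  refine Continuous.integrable_of_hasCompactSupport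
    ((h1.norm.pow 2).div continuous_bracket fun x => (bracket_pos x).ne') ?_
  refine (hφ.compactSupport.fderiv ℝ).mono' fun x hx => subset_closure ?_
  intro h
  refine hx ?_
  have : grad φ (param x) = 0 := by
    ext i
    have : fderiv ℝ (φ ∘ param) (coord (param x)) = 0 := h
    simp [grad, this]
  simp [this]

/-- The Poincaré inequality on hyperbolic space, for test functions. -/
theorem IsTestFunction.poincare {d : ℕ} (hd : 3 ≤ d) {φ : Hyp d → ℂ} (hφ : IsTestFunction φ) :
    ∫ p, ‖φ p‖ ^ 2 ∂vol d ≤ ∫ p, ‖grad φ p‖ ^ 2 ∂vol d := by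
  set w : E d → ℂ := φ ∘ param with hw
  have hwd : ∀ x, HasFDerivAt w (fderiv ℝ w x) x := fun x =>
    (hφ.smooth.differentiable (by simp) x).hasFDerivAt
  -- `F` is the density of `|φ|² μ` in the chart, so the Euclidean divergence theorem for `x F`
  -- becomes an identity on hyperbolic space.
  set F : E d → ℝ := fun x => ‖w x‖ ^ 2 / bracket x with hF
  have hFs : ContDiff ℝ ∞ F :=
    (hφ.smooth.norm_sq ℝ).div contDiff_bracket fun x => (bracket_pos x).ne'
  have hFc : HasCompactSupport F := by
    refine hφ.compactSupport.mono' fun x hx => subset_closure ?_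
    intro h
    exact hx (by simp only [hF, hw]; rw [h]; simp)
  obtain ⟨hi, h0⟩ := integral_euler_eq_zero hFs hFc
  have hder : ∀ x, fderiv ℝ F x x =
      (2 * inner ℝ (w x) (fderiv ℝ w x x)) / bracket x - ‖w x‖ ^ 2 * ‖x‖ ^ 2 / bracket x ^ 3 := by
    intro x
    have hb := bracket_pos x
    have hinv : HasFDerivAt (fun y => (bracket y)⁻¹)
        (-(bracket x ^ 2)⁻¹ • ((bracket x)⁻¹ • innerSL ℝ x)) x :=
      (hasDerivAt_inv hb.ne').comp_hasFDerivAt x (hasFDerivAt_bracket x)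
    have := ((hwd x).norm_sq).mul hinv
    have e : F = (fun y => ‖w y‖ ^ 2) * fun y => (bracket y)⁻¹ :=
      funext fun y => div_eq_mul_inv _ _
    rw [e, this.fderiv]
    simp
    field_simp
    ring
  -- Of the `d ≥ 3` copies of `F`, one absorbs the derivative of the weight `1/⟨x⟩`, one the term
  -- `|φ|²` from `2ab ≤ a² + b²`, and one remains.
  have hpt : ∀ x, ‖φ (param x)‖ ^ 2 / bracket x - ‖grad φ (param x)‖ ^ 2 / bracket x
      ≤ d * F x + fderiv ℝ F x x := by
    intro x
    have hb := bracket_pos x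
    have h1 : |inner ℝ (w x) (fderiv ℝ w x x)| ≤ ‖w x‖ * ‖grad φ (param x)‖ :=
      (abs_real_inner_le_norm _ _).trans
        (mul_le_mul_of_nonneg_left (norm_fderiv_self_le_grad φ x) (norm_nonneg _))
    have h2 := neg_le_of_abs_le h1
    have h3 : ‖w x‖ ^ 2 * ‖x‖ ^ 2 / bracket x ^ 3 ≤ ‖w x‖ ^ 2 / bracket x := by
      rw [div_le_div_iff₀ (by positivity) hb]
      have : ‖x‖ ^ 2 ≤ bracket x ^ 2 := by rw [bracket_sq]; linarith
      calc ‖w x‖ ^ 2 * ‖x‖ ^ 2 * bracket x ≤ ‖w x‖ ^ 2 * bracket x ^ 2 * bracket x := by gcongr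
        _ = _ := by ring
    have hd' : (3 : ℝ) ≤ d := by exact_mod_cast hd
    have h4 : 3 * F x ≤ d * F x := by
      have : 0 ≤ F x := by positivity
      gcongr
    have h5 : F x = ‖w x‖ ^ 2 / bracket x := rfl
    have h6 : φ (param x) = w x := rfl
    rw [hder, h6]
    have h7 : -(‖w x‖ ^ 2 / bracket x) - ‖grad φ (param x)‖ ^ 2 / bracket x
        ≤ (2 * inner ℝ (w x) (fderiv ℝ w x x)) / bracket x := by
      rw [← neg_div, ← sub_div]
      refine div_le_div_of_nonneg_right ?_ hb.le
      nlinarith [sq_nonneg (‖w x‖ - ‖grad φ (param x)‖)]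
    linarith
  rw [integral_vol, integral_vol, ← sub_nonpos]
  have hi1 := (integrable_vol _).1 hφ.integrable_norm_sq
  have hi2 := (integrable_vol _).1 hφ.integrable_grad_sq
  rw [← integral_sub hi1 hi2, ← h0]
  exact integral_mono (hi1.sub hi2) hi hpt

theorem norm_sq_eq_integral_of_ae {α G : Type*} {m : MeasurableSpace α} {μ : Measure α}
    [NormedAddCommGroup G] [InnerProductSpace ℂ G] (U : Lp G 2 μ) {φ : α → G} (h : U =ᵐ[μ] φ) :
    ‖U‖ ^ 2 = ∫ p, ‖φ p‖ ^ 2 ∂μ := by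
  have h1 : ((‖U‖ ^ 2 : ℝ) : ℂ) = ((∫ p, ‖φ p‖ ^ 2 ∂μ : ℝ) : ℂ) := by
    rw [← integral_complex_ofReal]
    push_cast
    refine (inner_self_eq_norm_sq_to_K (𝕜 := ℂ) U).symm.trans ?_
    rw [MeasureTheory.L2.inner_def]
    refine integral_congr_ae (h.mono fun p hp => ?_)
    simp only [hp]
    exact inner_self_eq_norm_sq_to_K (𝕜 := ℂ) (φ p)
  exact_mod_cast h1

theorem mem_testGraph {d : ℕ} {U : Pairs d} : U ∈ testGraph d ↔
    ∃ φ : Hyp d → ℂ, IsTestFunction φ ∧ U.fst =ᵐ[vol d] φ ∧ U.snd =ᵐ[vol d] grad φ :=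
  Iff.rfl

theorem mem_H1 {d : ℕ} {U : Pairs d} : U ∈ H1 d ↔ U ∈ closure (testGraph d : Set (Pairs d)) :=
  Iff.rfl

/-- The Poincaré inequality on hyperbolic space. -/
theorem norm_fst_le_norm_snd {d : ℕ} (hd : 3 ≤ d) {U : Pairs d} (h : U ∈ H1 d) :
    ‖U.fst‖ ≤ ‖U.snd‖ := by
  rw [mem_H1] at h
  have hc1 : Continuous fun U : Pairs d => ‖U.fst‖ :=
    (WithLp.fstL 2 ℂ (L2 d) (L2Field d)).continuous.norm
  have hc2 : Continuous fun U : Pairs d => ‖U.snd‖ :=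
    (WithLp.sndL 2 ℂ (L2 d) (L2Field d)).continuous.norm
  refine le_on_closure (f := fun U : Pairs d => ‖U.fst‖) (g := fun U : Pairs d => ‖U.snd‖)
    (fun V hV => ?_) hc1.continuousOn hc2.continuousOn h
  obtain ⟨φ, hφ, h1, h2⟩ := mem_testGraph.1 hV
  have key := hφ.poincare hd
  rw [← norm_sq_eq_integral_of_ae _ h1, ← norm_sq_eq_integral_of_ae _ h2] at key
  exact le_of_sq_le_sq key (norm_nonneg _)

/-! ### The maximum principle for the resolvent. -/

/-- The square of the complex numbers with real and imaginary part in `[-M, M]`. -/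
def box (M : ℝ) : Set ℂ := {z | |z.re| ≤ M ∧ |z.im| ≤ M}

theorem isClosed_box (M : ℝ) : IsClosed (box M) :=
  (isClosed_le Complex.continuous_re.abs continuous_const).inter
    (isClosed_le Complex.continuous_im.abs continuous_const)

theorem mem_box_of_norm_le {M : ℝ} {z : ℂ} (h : ‖z‖ ≤ M) : z ∈ box M :=
  ⟨(Complex.abs_re_le_norm z).trans h, (Complex.abs_im_le_norm z).trans h⟩

theorem norm_le_of_mem_box {M : ℝ} {z : ℂ} (h : z ∈ box M) : ‖z‖ ≤ 2 * M :=
  (Complex.norm_le_abs_re_add_abs_im z).trans (by linarith [h.1, h.2])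

/-- An `L²`-convergent sequence has an almost everywhere convergent subsequence. -/
theorem isClosed_ae_mem {α G : Type*} {m : MeasurableSpace α} {μ : Measure α}
    [NormedAddCommGroup G] {K : Set G} (hK : IsClosed K) :
    IsClosed {h : Lp G 2 μ | ∀ᵐ x ∂μ, h x ∈ K} := by
  refine IsSeqClosed.isClosed fun u h hu hh => ?_
  obtain ⟨ns, -, hns⟩ := (tendstoInMeasure_of_tendsto_Lp hh).exists_seq_tendsto_ae
  have hu' : ∀ᵐ x ∂μ, ∀ n, u n x ∈ K := ae_all_iff.2 hu
  filter_upwards [hns, hu'] with x hx hux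
  exact hK.mem_of_tendsto hx (Filter.Eventually.of_forall fun i => hux _)

/-- `τ` is the primitive of a bump function with values in `[0, 1]`, equal to `1` on `[-M, M]` and
to `0` beyond `M + ε`. The margin `ε` is the price of smoothness, needed so that truncation
preserves test functions. -/
theorem exists_smooth_truncation {M ε : ℝ} (hM : 0 < M) (hε : 0 < ε) :
    ∃ τ : ℝ → ℝ, ContDiff ℝ ∞ τ ∧ (∀ t, |t| ≤ M → τ t = t) ∧ (∀ s t, |τ s - τ t| ≤ |s - t|) ∧
      ∀ t, |τ t| ≤ M + ε := by
  let χ : ContDiffBump (0 : ℝ) := ⟨M, M + ε, hM, by linarith⟩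
  have hχ : Continuous χ := χ.continuous
  have hint : ∀ a b, IntervalIntegrable χ volume a b := fun a b => hχ.intervalIntegrable a b
  have hder : ∀ t, HasDerivAt (fun t => ∫ s in (0 : ℝ)..t, χ s) (χ t) t := fun t =>
    intervalIntegral.integral_hasDerivAt_right (hint _ _)
      hχ.stronglyMeasurable.stronglyMeasurableAtFilter hχ.continuousAt
  have hlip : ∀ s t, |(∫ r in (0 : ℝ)..s, χ r) - ∫ r in (0 : ℝ)..t, χ r| ≤ |s - t| := by
    intro s t
    rw [intervalIntegral.integral_interval_sub_left (hint _ _) (hint _ _), ← Real.norm_eq_abs]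
    refine (intervalIntegral.norm_integral_le_of_norm_le_const (C := 1) fun x _ => ?_).trans
      (by simp)
    rw [Real.norm_of_nonneg χ.nonneg]
    exact χ.le_one
  refine ⟨fun t => ∫ s in (0 : ℝ)..t, χ s, ?_, ?_, hlip, ?_⟩
  · rw [contDiff_infty_iff_deriv]
    refine ⟨fun t => (hder t).differentiableAt, ?_⟩
    rw [funext fun t => (hder t).deriv]
    exact χ.contDiff
  · intro t ht
    have : ∫ s in (0 : ℝ)..t, χ s = ∫ s in (0 : ℝ)..t, (1 : ℝ) := by
      refine intervalIntegral.integral_congr fun s hs => χ.one_of_mem_closedBall ?_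
      rw [mem_closedBall_zero_iff, Real.norm_eq_abs]
      refine le_trans ?_ ht
      have := Set.abs_sub_left_of_mem_uIcc hs
      simpa using this
    simpa using this
  · intro t
    rcases le_total |t| (M + ε) with h | h
    · simpa using (hlip t 0).trans (by simpa using h)
    · have h0 : ∀ s, M + ε ≤ |s| → χ s = 0 := fun s hs =>
        χ.zero_of_le_dist (by simpa using hs)
      rcases le_total 0 t with ht | ht
      · rw [abs_of_nonneg ht] at h
        have h1 := intervalIntegral.integral_add_adjacent_intervals (hint 0 (M + ε)) (hint (M + ε) t)
        have h2 : ∫ s in (M + ε)..t, χ s = ∫ s in (M + ε)..t, (0 : ℝ) :=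
          intervalIntegral.integral_congr fun s hs => h0 s (by
            rw [Set.uIcc_of_le h] at hs
            exact hs.1.trans (le_abs_self s))
        rw [h2] at h1
        have := hlip (M + ε) 0
        simp only [intervalIntegral.integral_zero, add_zero] at h1
        simp only [intervalIntegral.integral_same, sub_zero] at this
        beta_reduce
        rw [← h1]
        exact this.trans (abs_of_nonneg (by positivity)).le
      · rw [abs_of_nonpos ht] at h
        have h1 := intervalIntegral.integral_add_adjacent_intervals (hint 0 (-(M + ε)))
          (hint (-(M + ε)) t)
        have h2 : ∫ s in (-(M + ε))..t, χ s = ∫ s in (-(M + ε))..t, (0 : ℝ) :=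
          intervalIntegral.integral_congr fun s hs => h0 s (by
            rw [Set.uIcc_of_ge (by linarith)] at hs
            have := neg_abs_le s
            have := hs.2
            linarith [neg_le_abs s])
        rw [h2] at h1
        have := hlip (-(M + ε)) 0
        simp only [intervalIntegral.integral_zero, add_zero] at h1
        simp only [intervalIntegral.integral_same, sub_zero] at this
        beta_reduce
        rw [← h1]
        exact this.trans (by rw [abs_neg]; exact (abs_of_nonneg (by positivity)).le)

/-- A box rather than a disc lets the scalar truncation act on real and imaginary parts separately;
this later costs only a factor `2` in `L^∞` bounds. -/
theorem exists_smooth_contraction_to_box {M ε : ℝ} (hM : 0 < M) (hε : 0 < ε) :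
    ∃ T : ℂ → ℂ, ContDiff ℝ ∞ T ∧ (∀ z ∈ box M, T z = z) ∧ LipschitzWith 1 T ∧
      ∀ z, T z ∈ box (M + ε) := by
  obtain ⟨τ, h1, h2, h3, h4⟩ := exists_smooth_truncation hM hε
  refine ⟨fun z => (τ z.re : ℂ) + (τ z.im : ℂ) * Complex.I, ?_, ?_, ?_, ?_⟩
  · have e1 : ContDiff ℝ ∞ fun z : ℂ => (τ z.re : ℂ) :=
      Complex.ofRealCLM.contDiff.comp (h1.comp Complex.reCLM.contDiff)
    have e2 : ContDiff ℝ ∞ fun z : ℂ => (τ z.im : ℂ) :=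
      Complex.ofRealCLM.contDiff.comp (h1.comp Complex.imCLM.contDiff)
    exact e1.add (e2.mul contDiff_const)
  · intro z hz
    simp only [h2 _ hz.1, h2 _ hz.2, Complex.re_add_im]
  · refine LipschitzWith.of_dist_le_mul fun z w => ?_
    simp only [NNReal.coe_one, one_mul, dist_eq_norm]
    refine le_of_sq_le_sq ?_ (norm_nonneg _)
    simp only [Complex.sq_norm, Complex.normSq_apply, ← pow_two]
    simp
    exact add_le_add (sq_le_sq.2 (h3 _ _)) (sq_le_sq.2 (h3 _ _))
  · intro z
    refine ⟨?_, ?_⟩ <;> simpa using h4 _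

theorem IsTestFunction.comp_left {d : ℕ} {φ : Hyp d → ℂ} (hφ : IsTestFunction φ) {T : ℂ → ℂ}
    (hT : ContDiff ℝ ∞ T) (h0 : T 0 = 0) : IsTestFunction (T ∘ φ) :=
  ⟨hT.comp hφ.smooth, hφ.compactSupport.comp_left h0⟩

theorem IsTestFunction.norm_grad_comp_le {d : ℕ} {φ : Hyp d → ℂ} (hφ : IsTestFunction φ) {T : ℂ → ℂ}
    (hT : ContDiff ℝ ∞ T) (hl : LipschitzWith 1 T) (p : Hyp d) :
    ‖grad (T ∘ φ) p‖ ≤ ‖grad φ p‖ := by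
  refine le_of_sq_le_sq ?_ (norm_nonneg _)
  rw [EuclideanSpace.norm_sq_eq, EuclideanSpace.norm_sq_eq]
  refine Finset.sum_le_sum fun i _ => ?_
  have h : fderiv ℝ ((T ∘ φ) ∘ param) (coord p)
      = (fderiv ℝ T ((φ ∘ param) (coord p))).comp (fderiv ℝ (φ ∘ param) (coord p)) :=
    fderiv_comp (coord p) (hT.differentiable (by simp) _) (hφ.smooth.differentiable (by simp) _)
  simp only [grad, h, ContinuousLinearMap.comp_apply]
  gcongr
  refine (ContinuousLinearMap.le_opNorm _ _).trans ?_
  have := norm_fderiv_le_of_lipschitz ℝ hl (x₀ := (φ ∘ param) (coord p))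
  exact mul_le_of_le_one_left (norm_nonneg _) (by simpa using this)

/-- Completing the square in the quadratic functional `‖v - g‖² + ‖∇v‖²` on `H¹`. -/
theorem norm_sub_adjoint_sq {d : ℕ} (g : L2 d) (V : H1 d) :
    ‖V - (inclusion d).adjoint g‖ ^ 2 =
      ‖V.1.fst - g‖ ^ 2 + ‖V.1.snd‖ ^ 2 + (‖(inclusion d).adjoint g‖ ^ 2 - ‖g‖ ^ 2) := by
  rw [@norm_sub_sq ℂ, @norm_sub_sq ℂ _ _ _ _ V.1.fst, ContinuousLinearMap.adjoint_inner_right]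
  have h1 : ‖V‖ ^ 2 = ‖V.1.fst‖ ^ 2 + ‖V.1.snd‖ ^ 2 := WithLp.prod_norm_sq_eq_of_L2 V.1
  have h2 : inclusion d V = V.1.fst := rfl
  rw [h1, h2]
  ring

/-- By `norm_sub_adjoint_sq`, the distance to `J* g` is measured by `‖v - g‖² + ‖∇v‖²`. Composing
with a contraction that fixes the values of `g` increases neither term. -/
theorem exists_truncation_closer {d : ℕ} {g : L2 d} {M ε : ℝ} (hM : 0 < M) (hε : 0 < ε)
    (hg : ∀ᵐ p ∂vol d, g p ∈ box M) (V : H1 d) (hV : V.1 ∈ testGraph d) :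
    ∃ W : H1 d, (∀ᵐ p ∂vol d, inclusion d W p ∈ box (M + ε)) ∧
      ‖W - (inclusion d).adjoint g‖ ≤ ‖V - (inclusion d).adjoint g‖ := by
  obtain ⟨φ, hφ, h1, h2⟩ := mem_testGraph.1 hV
  obtain ⟨T, hT, hTid, hl, hb⟩ := exists_smooth_contraction_to_box hM hε
  have hT0 : T 0 = 0 := hTid 0 (mem_box_of_norm_le (by simpa using hM.le))
  have ht := hφ.comp_left hT hT0
  have hTle : ∀ z, ‖T z‖ ≤ ‖z‖ := fun z => by
    simpa [hT0] using hl.dist_le_mul z 0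
  have m1 : MemLp (T ∘ φ) 2 (vol d) :=
    (Lp.memLp V.1.fst).of_le ht.continuous.aestronglyMeasurable
      (h1.mono fun p hp => by rw [hp]; exact hTle _)
  have m2 : MemLp (grad (T ∘ φ)) 2 (vol d) :=
    (Lp.memLp V.1.snd).of_le ht.continuous_grad.aestronglyMeasurable
      (h2.mono fun p hp => by rw [hp]; exact hφ.norm_grad_comp_le hT hl p)
  let W : Pairs d := WithLp.toLp 2 (m1.toLp _, m2.toLp _)
  have hW : W ∈ testGraph d := mem_testGraph.2 ⟨T ∘ φ, ht, m1.coeFn_toLp, m2.coeFn_toLp⟩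
  refine ⟨⟨W, subset_closure hW⟩, ?_, ?_⟩
  · filter_upwards [m1.coeFn_toLp] with p hp
    change m1.toLp _ p ∈ _
    rw [hp]
    exact hb _
  · refine le_of_sq_le_sq ?_ (norm_nonneg _)
    rw [norm_sub_adjoint_sq, norm_sub_adjoint_sq]
    have e1 : ‖m1.toLp _ - g‖ ≤ ‖V.1.fst - g‖ := by
      refine Lp.norm_le_norm_of_ae_le ?_
      filter_upwards [Lp.coeFn_sub (m1.toLp _) g, Lp.coeFn_sub V.1.fst g, m1.coeFn_toLp, h1, hg]
        with p a1 a2 a3 a4 a5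
      rw [a1, a2, Pi.sub_apply, Pi.sub_apply, a3, a4]
      have := hl.dist_le_mul (φ p) (g p)
      rw [hTid _ a5] at this
      simpa [dist_eq_norm] using this
    have e2 : ‖m2.toLp _‖ ≤ ‖V.1.snd‖ := by
      refine Lp.norm_le_norm_of_ae_le ?_
      filter_upwards [m2.coeFn_toLp, h2] with p a1 a2
      rw [a1, a2]
      exact hφ.norm_grad_comp_le hT hl p
    gcongr
    · exact e1
    · exact e2

/-- The maximum principle for the resolvent `(1 - Δ)⁻¹`. -/
theorem resolvent_mem_box {d : ℕ} {g : L2 d} {M : ℝ} (hM : 0 < M)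
    (hg : ∀ᵐ p ∂vol d, g p ∈ box M) : ∀ᵐ p ∂vol d, resolvent d g p ∈ box M := by
  set U := (inclusion d).adjoint g with hU
  have key : ∀ ε, 0 < ε → ∀ᵐ p ∂vol d, resolvent d g p ∈ box (M + ε) := by
    intro ε hε
    have hcl : IsClosed {W : H1 d | ∀ᵐ p ∂vol d, inclusion d W p ∈ box (M + ε)} :=
      (isClosed_ae_mem (isClosed_box (M + ε))).preimage (inclusion d).continuous
    -- Test functions approximate the minimizer `J* g`, and their truncations are at least as close
    -- to it.
    have hmem : U ∈ closure {W : H1 d | ∀ᵐ p ∂vol d, inclusion d W p ∈ box (M + ε)} := by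
      rw [Metric.mem_closure_iff]
      intro r hr
      obtain ⟨V, hV, hVr⟩ := Metric.mem_closure_iff.1 (mem_H1.1 U.2) r hr
      obtain ⟨W, hW, hWV⟩ := exists_truncation_closer hM hε hg ⟨V, subset_closure hV⟩ hV
      refine ⟨W, hW, ?_⟩
      rw [dist_comm, dist_eq_norm]
      refine hWV.trans_lt ?_
      rw [dist_comm, dist_eq_norm] at hVr
      exact hVr
    rw [hcl.closure_eq] at hmem
    exact hmem
  have h := ae_all_iff.2 fun n : ℕ => key (1 / ((n : ℝ) + 1)) (by positivity)
  filter_upwards [h] with p hp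
  have ht : Filter.Tendsto (fun n : ℕ => M + 1 / ((n : ℝ) + 1)) Filter.atTop (nhds (M + 0)) :=
    tendsto_const_nhds.add tendsto_one_div_add_atTop_nhds_zero_nat
  rw [add_zero] at ht
  exact ⟨ge_of_tendsto' ht fun n => (hp n).1, ge_of_tendsto' ht fun n => (hp n).2⟩

/-! ### Scalar inequalities for the symbols. -/

/-- `(1 - s z) e^{s z}` with `z = 1 - t⁻¹`, as a function of the spectral variable `t` of the
resolvent. -/
def lowSymbol (s t : ℝ) : ℝ :=
  if 0 < t then (1 - s * (1 - t⁻¹)) * Real.exp (s * (1 - t⁻¹)) else 0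

/-- `s z² e^{s z}` with `z = 1 - t⁻¹`, as a function of the spectral variable `t` of the
resolvent. -/
def bandSymbol (s t : ℝ) : ℝ :=
  if 0 < t then s * (1 - t⁻¹) ^ 2 * Real.exp (s * (1 - t⁻¹)) else 0

theorem continuous_lowSymbol {s : ℝ} (hs : 0 < s) : Continuous (lowSymbol s) := by
  refine ((continuous_symbol 1 s hs 0).add (continuous_symbol (-s) s hs 1)).congr fun t => ?_
  by_cases ht : 0 < t
  · simp only [Pi.add_apply, lowSymbol, ht, if_true]; ring
  · simp [lowSymbol, ht]

theorem continuous_bandSymbol {s : ℝ} (hs : 0 < s) : Continuous (bandSymbol s) :=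
  continuous_symbol s s hs 2

theorem bandSymbol_nonneg {s : ℝ} (hs : 0 < s) (t : ℝ) : 0 ≤ bandSymbol s t := by
  unfold bandSymbol
  split_ifs
  · positivity
  · exact le_rfl

theorem pow_mul_exp_neg_le {x : ℝ} (hx : 0 ≤ x) (n : ℕ) :
    x ^ n * Real.exp (-x) ≤ n.factorial := by
  have h := Real.pow_div_factorial_le_exp x hx n
  rw [div_le_iff₀ (by positivity)] at h
  rw [Real.exp_neg, ← div_eq_mul_inv, div_le_iff₀ (Real.exp_pos x)]
  linarith

theorem bandSymbol_le {s t : ℝ} (hs : 0 < s) (ht : t ≤ 1 / 2) : bandSymbol s t ≤ 2 / s := by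
  unfold bandSymbol
  split_ifs with h
  · have ha : 0 ≤ t⁻¹ - 1 := by
      have : 1 ≤ t⁻¹ := (one_le_inv₀ h).2 (by linarith)
      linarith
    have := pow_mul_exp_neg_le (mul_nonneg hs.le ha) 2
    have e : s * (1 - t⁻¹) = -(s * (t⁻¹ - 1)) := by ring
    rw [e, le_div_iff₀ hs]
    calc _ = (s * (t⁻¹ - 1)) ^ 2 * Real.exp (-(s * (t⁻¹ - 1))) := by ring
      _ ≤ _ := by simpa [Nat.factorial] using this
  · positivity

/-- With `x = s(t⁻¹ - 1)` the symbol is `x² e^{-x}/s`; one more power of `x`, available since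
`2t(t⁻¹ - 1) ≥ 1`, is traded for a factor `t`. This supplies joint continuity in `(s, t)` at `t =
0`, where the formula is singular. -/
theorem bandSymbol_le_mul {s t : ℝ} (hs : 0 < s) (h0 : 0 ≤ t) (ht : t ≤ 1 / 2) :
    bandSymbol s t ≤ 12 / s ^ 2 * t := by
  unfold bandSymbol
  split_ifs with h
  · have ha : 0 ≤ t⁻¹ - 1 := by
      have : 1 ≤ t⁻¹ := (one_le_inv₀ h).2 (by linarith)
      linarith
    have hat : 1 ≤ 2 * t * (t⁻¹ - 1) := by
      have : t * t⁻¹ = 1 := mul_inv_cancel₀ h.ne'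
      nlinarith
    have := pow_mul_exp_neg_le (mul_nonneg hs.le ha) 3
    have e : s * (1 - t⁻¹) = -(s * (t⁻¹ - 1)) := by ring
    rw [e, div_mul_eq_mul_div, le_div_iff₀ (by positivity)]
    calc _ = (s * (t⁻¹ - 1)) ^ 2 * Real.exp (-(s * (t⁻¹ - 1))) * s * 1 := by ring
      _ ≤ (s * (t⁻¹ - 1)) ^ 2 * Real.exp (-(s * (t⁻¹ - 1))) * s * (2 * t * (t⁻¹ - 1)) := by
        gcongr
      _ = 2 * t * ((s * (t⁻¹ - 1)) ^ 3 * Real.exp (-(s * (t⁻¹ - 1)))) := by ring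
      _ ≤ 2 * t * 6 := by
        gcongr
        simpa [Nat.factorial] using this
      _ = _ := by ring
  · positivity

theorem continuousOn_uncurry_bandSymbol {s₀ s₁ : ℝ} (h0 : 0 < s₀) :
    ContinuousOn (Function.uncurry bandSymbol) (Set.Icc s₀ s₁ ×ˢ Set.Icc 0 (1 / 2)) := by
  rintro ⟨s, t⟩ ⟨hs, ht⟩
  have hs0 : 0 < s := h0.trans_le hs.1
  rcases ht.1.eq_or_lt with h | h
  · have h' : t = 0 := h.symm
    subst h'
    have hz : Function.uncurry bandSymbol (s, 0) = 0 := by simp [bandSymbol]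
    rw [ContinuousWithinAt, hz]
    have hlim : Filter.Tendsto (fun q : ℝ × ℝ => 12 / q.1 ^ 2 * q.2)
        (nhdsWithin (s, 0) (Set.Icc s₀ s₁ ×ˢ Set.Icc 0 (1 / 2))) (nhds 0) := by
      have : ContinuousAt (fun q : ℝ × ℝ => 12 / q.1 ^ 2 * q.2) (s, 0) := by
        refine ContinuousAt.mul (ContinuousAt.div continuousAt_const (by fun_prop) ?_) (by fun_prop)
        exact (pow_pos hs0 2).ne'
      have := this.tendsto
      simp only [mul_zero] at this
      exact this.mono_left nhdsWithin_le_nhds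
    refine tendsto_of_tendsto_of_tendsto_of_le_of_le' tendsto_const_nhds hlim ?_ ?_
    · filter_upwards [self_mem_nhdsWithin] with q hq
      exact bandSymbol_nonneg (h0.trans_le hq.1.1) _
    · filter_upwards [self_mem_nhdsWithin] with q hq
      exact bandSymbol_le_mul (h0.trans_le hq.1.1) hq.2.1 hq.2.2
  · refine ContinuousAt.continuousWithinAt ?_
    have hc : ContinuousAt (fun q : ℝ × ℝ => q.1 * (1 - q.2⁻¹) ^ 2 * Real.exp (q.1 * (1 - q.2⁻¹)))
        (s, t) := by
      have : ContinuousAt (fun q : ℝ × ℝ => q.2⁻¹) (s, t) :=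
        ContinuousAt.inv₀ (by fun_prop) h.ne'
      fun_prop
    refine hc.congr ?_
    have : ∀ᶠ q : ℝ × ℝ in nhds (s, t), 0 < q.2 :=
      continuousAt_snd.eventually (lt_mem_nhds h)
    filter_upwards [this] with q hq
    simp [Function.uncurry, bandSymbol, hq]

/-- `-(1 - sz) e^{sz}` is a primitive in `s` of `s z² e^{sz}`. -/
theorem lowSymbol_sub_lowSymbol {s₀ s₁ : ℝ} (h : s₀ ≤ s₁) (t : ℝ) :
    lowSymbol s₀ t - lowSymbol s₁ t = ∫ s in Set.Icc s₀ s₁, bandSymbol s t := by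
  rw [integral_Icc_eq_integral_Ioc, ← intervalIntegral.integral_of_le h]
  unfold lowSymbol bandSymbol
  by_cases ht : 0 < t
  · simp only [ht, if_true]
    set z := 1 - t⁻¹
    have hd : ∀ s ∈ Set.uIcc s₀ s₁, HasDerivAt (fun s => -((1 - s * z) * Real.exp (s * z)))
        (s * z ^ 2 * Real.exp (s * z)) s := by
      intro s _
      have h1 : HasDerivAt (fun s : ℝ => s * z) z s := by simpa using (hasDerivAt_id s).mul_const z
      convert! ((h1.const_sub 1).mul h1.exp).neg using 1
      ring
    rw [intervalIntegral.integral_eq_sub_of_hasDerivAt hd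
      (Continuous.intervalIntegrable (by fun_prop) _ _)]
    ring
  · simp [ht]

/-- With `x = s(t⁻¹ - 1)` the left side is `(1 - (1 + x)e^{-x})² ≤ min(x⁴, 1)` and the right side is
`10x²/((1 + x)(4 + x))`. The latter is written as a difference between the scales `s` and `s/4` so
that it telescopes over `s = 4^{-k}`; the constant makes `(1 + x)(4 + x) = 10` at the crossover `x =
1`. -/
theorem one_sub_lowSymbol_sq_le {s t : ℝ} (hs : 0 < s) (h0 : 0 < t) (ht : t ≤ 1) :
    (1 - lowSymbol s t) ^ 2 ≤ 10 / 3 * (s * (t⁻¹ - 1)) *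
      (s * (t⁻¹ - 1) / (1 + s * (t⁻¹ - 1)) -
        s / 4 * (t⁻¹ - 1) / (1 + s / 4 * (t⁻¹ - 1))) := by
  have ha : 0 ≤ t⁻¹ - 1 := by
    have : 1 ≤ t⁻¹ := (one_le_inv₀ h0).2 (by linarith)
    linarith
  have e1 : lowSymbol s t = (1 + s * (t⁻¹ - 1)) * Real.exp (-(s * (t⁻¹ - 1))) := by
    simp only [lowSymbol, h0, if_true]
    ring_nf
  have e2 : s / 4 * (t⁻¹ - 1) = (s * (t⁻¹ - 1)) / 4 := by ring
  rw [e1, e2]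
  set x := s * (t⁻¹ - 1) with hx
  have hx0 : 0 ≤ x := mul_nonneg hs.le ha
  have hpos : 0 ≤ (1 + x) * Real.exp (-x) := by positivity
  have hle1 : (1 + x) * Real.exp (-x) ≤ 1 := by
    rw [Real.exp_neg, ← div_eq_mul_inv, div_le_one (Real.exp_pos x)]
    linarith [Real.add_one_le_exp x]
  have hge : 1 - x ^ 2 ≤ (1 + x) * Real.exp (-x) := by
    have := Real.add_one_le_exp (-x)
    nlinarith
  have e3 : 10 / 3 * x * (x / (1 + x) - x / 4 / (1 + x / 4)) = 10 * x ^ 2 / ((1 + x) * (4 + x)) := by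
    field_simp
    ring
  rw [e3, le_div_iff₀ (by positivity)]
  set y := 1 - (1 + x) * Real.exp (-x) with hy
  have hy0 : 0 ≤ y := by linarith
  have hy1 : y ≤ 1 := by linarith
  have hy2 : y ≤ x ^ 2 := by linarith
  rcases le_total x 1 with h | h
  · have : y ^ 2 ≤ x ^ 2 := by nlinarith
    have h3 : (1 + x) * (4 + x) ≤ 10 := by nlinarith
    calc y ^ 2 * ((1 + x) * (4 + x)) ≤ x ^ 2 * 10 := by gcongr
      _ = _ := by ring
  · have : y ^ 2 ≤ 1 := by nlinarith
    calc y ^ 2 * ((1 + x) * (4 + x)) ≤ 1 * (10 * x ^ 2) :=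
          mul_le_mul this (by nlinarith) (by positivity) (by norm_num)
      _ = _ := by ring

theorem sum_one_sub_lowSymbol_sq_le (K : ℕ) {t : ℝ} (h0 : 0 ≤ t) (ht : t ≤ 1) :
    (∑ k ∈ Finset.range K, 4 ^ k * (1 - lowSymbol ((4 ^ k)⁻¹) t) ^ 2) * t ≤ 10 / 3 := by
  rcases h0.eq_or_lt with h | h
  · rw [← h]; norm_num
  have ha : 0 ≤ t⁻¹ - 1 := by
    have : 1 ≤ t⁻¹ := (one_le_inv₀ h).2 (by linarith)
    linarith
  -- The weight `4^k` cancels the prefactor `s = 4^{-k}`, leaving `(10/3)(t⁻¹ - 1)(Φ k - Φ (k +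
  -- 1))`; multiplying the telescoped sum by `t` bounds it uniformly in `K`.
  set Φ : ℕ → ℝ := fun k => (4 ^ k)⁻¹ * (t⁻¹ - 1) / (1 + (4 ^ k)⁻¹ * (t⁻¹ - 1)) with hΦ
  have hterm : ∀ k : ℕ, 4 ^ k * (1 - lowSymbol ((4 ^ k)⁻¹) t) ^ 2
      ≤ 10 / 3 * (t⁻¹ - 1) * (Φ k - Φ (k + 1)) := by
    intro k
    have h1 := one_sub_lowSymbol_sq_le (s := ((4 : ℝ) ^ k)⁻¹) (by positivity) h ht
    have e : ((4 : ℝ) ^ k)⁻¹ / 4 = (4 ^ (k + 1))⁻¹ := by rw [pow_succ]; field_simp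
    rw [e] at h1
    calc _ ≤ 4 ^ k * (10 / 3 * ((4 ^ k)⁻¹ * (t⁻¹ - 1)) * (Φ k - Φ (k + 1))) := by gcongr
      _ = _ := by field_simp
  have hΦ0 : Φ 0 ≤ 1 := by
    simp only [hΦ, pow_zero, inv_one, one_mul]
    rw [div_le_one (by positivity)]; linarith
  have hΦK : 0 ≤ Φ K := by positivity
  calc _ ≤ (∑ k ∈ Finset.range K, 10 / 3 * (t⁻¹ - 1) * (Φ k - Φ (k + 1))) * t := by
        exact mul_le_mul_of_nonneg_right (Finset.sum_le_sum fun k _ => hterm k) h.le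
    _ = 10 / 3 * ((t⁻¹ - 1) * t) * (Φ 0 - Φ K) := by
        rw [← Finset.mul_sum, Finset.sum_range_sub']; ring
    _ = 10 / 3 * (1 - t) * (Φ 0 - Φ K) := by rw [sub_mul, inv_mul_cancel₀ h.ne', one_mul]
    _ ≤ 10 / 3 * 1 * 1 := by
        have : Φ 0 - Φ K ≤ 1 := by linarith
        have h1 : 0 ≤ 1 - t := by linarith
        calc _ ≤ 10 / 3 * (1 - t) * 1 := by gcongr
          _ ≤ _ := by linarith
    _ = _ := by norm_num

/-! ### Consequences of the functional calculus for `R = J J*`. -/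

section Spectral

variable {H G : Type*} [NormedAddCommGroup H] [InnerProductSpace ℂ H] [CompleteSpace H]
  [NormedAddCommGroup G] [InnerProductSpace ℂ G] [CompleteSpace G]

theorem spectrum_comp_adjoint_subset (J : G →L[ℂ] H) {c : ℝ} (hc : ‖J ∘L J.adjoint‖ ≤ c) :
    spectrum ℝ (J ∘L J.adjoint) ⊆ Set.Icc 0 c := by
  intro t ht
  refine ⟨?_, ?_⟩
  · have h := (ContinuousLinearMap.nonneg_iff_isPositive _).2
      (ContinuousLinearMap.isPositive_self_comp_adjoint J)
    exact spectrum_nonneg_of_nonneg h ht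
  · have h1 := spectrum.norm_le_norm_mul_of_mem ht
    have h2 : ‖(1 : H →L[ℂ] H)‖ ≤ 1 := ContinuousLinearMap.norm_id_le
    calc t ≤ ‖t‖ := le_abs_self t
      _ ≤ ‖J ∘L J.adjoint‖ * 1 := h1.trans (by gcongr)
      _ ≤ c := by simpa using hc

theorem isSelfAdjoint_comp_adjoint (J : G →L[ℂ] H) : IsSelfAdjoint (J ∘L J.adjoint) :=
  (ContinuousLinearMap.isPositive_self_comp_adjoint J).isSelfAdjoint

theorem norm_cfc_apply_sq (R : H →L[ℂ] H) {m : ℝ → ℝ} (hm : Continuous m)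
    (f : H) : ‖cfc m R f‖ ^ 2 = RCLike.re (inner ℂ (cfc (fun t => m t ^ 2) R f) f) := by
  have hs : IsSelfAdjoint (cfc m R) := cfc_predicate m R
  have h1 : cfc (fun t => m t ^ 2) R = cfc m R * cfc m R := by
    rw [← cfc_mul m m R hm.continuousOn hm.continuousOn]
    simp only [pow_two]
  rw [h1, mul_apply_eq_comp, ← ContinuousLinearMap.adjoint_inner_right,
    ContinuousLinearMap.isSelfAdjoint_iff'.1 hs]
  exact (inner_self_eq_norm_sq _).symm

/-- A `T T*` argument: with `b = (∑ w_k m_k²)^{1/2}`, the sum is `‖b(R) J u‖²`, and `‖b(R) J‖² =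
‖b(R) J J* b(R)‖` is the norm of the function `t b(t)²` of `R`. The factor `t` records the gain from
measuring `u` in `H¹` instead of `L²`. -/
theorem sum_norm_cfc_apply_sq_le (J : G →L[ℂ] H) {m : ℕ → ℝ → ℝ} (hm : ∀ k, Continuous (m k))
    {w : ℕ → ℝ} (hw : ∀ k, 0 ≤ w k) (K : ℕ) {C : ℝ} (hC : 0 ≤ C)
    (h : ∀ t ∈ spectrum ℝ (J ∘L J.adjoint), (∑ k ∈ Finset.range K, w k * m k t ^ 2) * t ≤ C)
    (u : G) :
    ∑ k ∈ Finset.range K, w k * ‖cfc (m k) (J ∘L J.adjoint) (J u)‖ ^ 2 ≤ C * ‖u‖ ^ 2 := by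
  set R := J ∘L J.adjoint with hRdef
  have hR : IsSelfAdjoint R := isSelfAdjoint_comp_adjoint J
  set β : ℝ → ℝ := fun t => ∑ k ∈ Finset.range K, w k * m k t ^ 2 with hβ
  have hβc : Continuous β := continuous_finsetSum _ fun k _ => continuous_const.mul ((hm k).pow 2)
  have hβ0 : ∀ t, 0 ≤ β t := fun t => Finset.sum_nonneg fun k _ => mul_nonneg (hw k) (sq_nonneg _)
  have e1 : cfc β R = ∑ k ∈ Finset.range K, w k • cfc (fun t => m k t ^ 2) R := by
    have := cfc_sum (fun k t => w k * m k t ^ 2) R (Finset.range K)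
      (fun k _ => (continuous_const.mul ((hm k).pow 2)).continuousOn)
    have e : β = ∑ k ∈ Finset.range K, (fun t => w k * m k t ^ 2) := by
      funext t; simp [hβ]
    rw [e, this]
    refine Finset.sum_congr rfl fun k _ => ?_
    exact cfc_smul (w k) (fun t => m k t ^ 2) R ((hm k).pow 2).continuousOn
  set b : ℝ → ℝ := fun t => √(β t) with hb
  have hbc : Continuous b := hβc.sqrt
  have e2 : (fun t => b t ^ 2) = β := funext fun t => Real.sq_sqrt (hβ0 t)
  have e3 : ∑ k ∈ Finset.range K, w k * ‖cfc (m k) R (J u)‖ ^ 2 = ‖cfc b R (J u)‖ ^ 2 := by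
    rw [norm_cfc_apply_sq R hbc, e2, e1, sum_apply, sum_inner, map_sum]
    refine Finset.sum_congr rfl fun k _ => ?_
    rw [norm_cfc_apply_sq R (hm k), smul_apply, ← Complex.coe_smul (w k),
      inner_smul_left]
    simp
  have hs : IsSelfAdjoint (cfc b R) := cfc_predicate b R
  have e4 : ‖cfc b R ∘L J‖ * ‖cfc b R ∘L J‖ ≤ C := by
    have h1 := ContinuousLinearMap.norm_adjoint_comp_self (cfc b R ∘L J).adjoint
    rw [ContinuousLinearMap.adjoint_adjoint, LinearIsometryEquiv.norm_map] at h1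
    rw [← h1, ContinuousLinearMap.adjoint_comp, ContinuousLinearMap.isSelfAdjoint_iff'.1 hs]
    have e5 : (cfc b R ∘L J) ∘L (J.adjoint ∘L cfc b R) = cfc (fun t => b t * (t * b t)) R := by
      rw [cfc_mul b (fun t => t * b t) R hbc.continuousOn (by fun_prop),
        cfc_mul (fun t => t) b R (by fun_prop) hbc.continuousOn, cfc_id' ℝ R]
      rfl
    rw [e5]
    refine norm_cfc_le hC fun t ht => ?_
    have ht0 : 0 ≤ t := (spectrum_comp_adjoint_subset J le_rfl ht).1
    have e6 : b t * (t * b t) = β t * t := by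
      rw [← congrFun e2 t]; ring
    rw [e6, Real.norm_of_nonneg (mul_nonneg (hβ0 t) ht0)]
    exact h t ht
  rw [e3]
  calc ‖cfc b R (J u)‖ ^ 2 ≤ (‖cfc b R ∘L J‖ * ‖u‖) ^ 2 := by
        gcongr
        exact (cfc b R ∘L J).le_opNorm u
    _ = (‖cfc b R ∘L J‖ * ‖cfc b R ∘L J‖) * ‖u‖ ^ 2 := by ring
    _ ≤ _ := by gcongr

/-- `(1 - s A) e^{s A}` for `R = (1 - A)⁻¹`. -/
def lowPart (R : H →L[ℂ] H) (s : ℝ) : H →L[ℂ] H := cfc (lowSymbol s) R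

/-- `s A² e^{s A}` for `R = (1 - A)⁻¹`. -/
def bandPart (R : H →L[ℂ] H) (s : ℝ) : H →L[ℂ] H := cfc (bandSymbol s) R

theorem functionOfGenerator_eq_bandPart (R : H →L[ℂ] H) {l : ℝ} (hl : 0 < l) :
    functionOfGenerator R (fun z => 2 * (l ^ 4)⁻¹ * z ^ 2 * Real.exp ((l ^ 2)⁻¹ * z))
      = (2 * (l ^ 2)⁻¹) • bandPart R (l ^ 2)⁻¹ := by
  rw [bandPart, ← cfc_smul (2 * (l ^ 2)⁻¹) (bandSymbol (l ^ 2)⁻¹) R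
    (continuous_bandSymbol (by positivity)).continuousOn, functionOfGenerator]
  congr 1
  funext t
  by_cases ht : 0 < t
  · simp only [ht, if_true, bandSymbol, smul_eq_mul]
    ring
  · simp [bandSymbol, ht]

theorem norm_bandPart_one_le {R : H →L[ℂ] H} (hspec : spectrum ℝ R ⊆ Set.Icc 0 (1 / 2)) :
    ‖bandPart R 1‖ ≤ 2 := by
  refine norm_cfc_le (by norm_num) fun t ht => ?_
  rw [Real.norm_of_nonneg (bandSymbol_nonneg one_pos t)]
  simpa using bandSymbol_le one_pos (hspec ht).2

theorem sum_norm_sub_lowPart_sq_le (J : G →L[ℂ] H)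
    (hspec : spectrum ℝ (J ∘L J.adjoint) ⊆ Set.Icc 0 (1 / 2)) (K : ℕ) (u : G) :
    ∑ k ∈ Finset.range K, 4 ^ k * ‖J u - lowPart (J ∘L J.adjoint) (4 ^ k)⁻¹ (J u)‖ ^ 2
      ≤ 10 / 3 * ‖u‖ ^ 2 := by
  have hR : IsSelfAdjoint (J ∘L J.adjoint) := isSelfAdjoint_comp_adjoint J
  have hc : ∀ k : ℕ, Continuous (lowSymbol ((4 : ℝ) ^ k)⁻¹) := fun k =>
    continuous_lowSymbol (by positivity)
  have h := sum_norm_cfc_apply_sq_le J (m := fun k t => 1 - lowSymbol ((4 : ℝ) ^ k)⁻¹ t)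
    (fun k => continuous_const.sub (hc k)) (w := fun k => 4 ^ k) (fun k => by positivity) K
    (C := 10 / 3) (by norm_num)
    (fun t ht => sum_one_sub_lowSymbol_sq_le K (hspec ht).1 (by linarith [(hspec ht).2])) u
  refine le_trans (le_of_eq (Finset.sum_congr rfl fun k _ => ?_)) h
  rw [cfc_sub (fun _ => 1) (lowSymbol ((4 : ℝ) ^ k)⁻¹) _ continuous_const.continuousOn
    (hc k).continuousOn, cfc_const_one ℝ (J ∘L J.adjoint)]
  rfl

theorem cfc_lowSymbol_sub {R : H →L[ℂ] H} (hR : IsSelfAdjoint R)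
    (hspec : spectrum ℝ R ⊆ Set.Icc 0 (1 / 2)) {s₀ s₁ : ℝ} (h0 : 0 < s₀) (h : s₀ ≤ s₁) :
    IntegrableOn (fun s => cfc (bandSymbol s) R) (Set.Icc s₀ s₁) ∧
    cfc (lowSymbol s₀) R - cfc (lowSymbol s₁) R
      = ∫ s in Set.Icc s₀ s₁, cfc (bandSymbol s) R := by
  have h1 : 0 < s₁ := h0.trans_le h
  have hcont := (continuousOn_uncurry_bandSymbol (s₁ := s₁) h0).mono
    (Set.prod_mono_right (s := Set.Icc s₀ s₁) hspec)
  have hbound : ∀ᵐ s ∂volume.restrict (Set.Icc s₀ s₁), ∀ t ∈ spectrum ℝ R,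
      ‖bandSymbol s t‖ ≤ 2 / s₀ := by
    refine ae_restrict_of_forall_mem measurableSet_Icc fun s hs t ht => ?_
    have hs0 : 0 < s := h0.trans_le hs.1
    rw [Real.norm_of_nonneg (bandSymbol_nonneg hs0 t)]
    refine (bandSymbol_le hs0 (hspec ht).2).trans ?_
    have := hs.1
    gcongr
  have hfin : HasFiniteIntegral (fun _ : ℝ => 2 / s₀) (volume.restrict (Set.Icc s₀ s₁)) :=
    (integrable_const (2 / s₀)).hasFiniteIntegral
  refine ⟨integrableOn_cfc measurableSet_Icc bandSymbol _ R hcont hbound hfin hR, ?_⟩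
  rw [← cfc_sub (lowSymbol s₀) (lowSymbol s₁) R (continuous_lowSymbol h0).continuousOn
    (continuous_lowSymbol h1).continuousOn]
  simp only [lowSymbol_sub_lowSymbol h]
  exact cfc_setIntegral measurableSet_Icc bandSymbol _ R hcont hbound hfin hR

/-- The left side is the average of `bandPart R s f` over `[s₀, s₁]`, and a closed convex set
contains averages. Taking for `S` an `L^∞` ball inside `L²` transfers pointwise bounds through a
Bochner integral in `L²`. -/
theorem lowPart_sub_apply_mem {R : H →L[ℂ] H} (hR : IsSelfAdjoint R)
    (hspec : spectrum ℝ R ⊆ Set.Icc 0 (1 / 2)) {s₀ s₁ : ℝ} (h0 : 0 < s₀) (h : s₀ < s₁) {f : H}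
    {S : Set H} (hS : Convex ℝ S) (hSc : IsClosed S)
    (hf : ∀ s ∈ Set.Icc s₀ s₁, bandPart R s f ∈ S) :
    (s₁ - s₀)⁻¹ • (lowPart R s₀ f - lowPart R s₁ f) ∈ S := by
  obtain ⟨hi, he⟩ := cfc_lowSymbol_sub hR hspec h0 h.le
  have e : cfc (lowSymbol s₀) R f - cfc (lowSymbol s₁) R f
      = ∫ s in Set.Icc s₀ s₁, cfc (bandSymbol s) R f := by
    rw [← sub_apply, he, ContinuousLinearMap.integral_apply hi]
  have hv : volume.real (Set.Icc s₀ s₁) = s₁ - s₀ := by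
    simp [Measure.real, ENNReal.toReal_ofReal (sub_nonneg.2 h.le)]
  have := hS.set_average_mem hSc (μ := volume) (t := Set.Icc s₀ s₁)
    (f := fun s => cfc (bandSymbol s) R f) (by simp [h]) (by simp)
    (ae_restrict_of_forall_mem measurableSet_Icc hf) (hi.apply_continuousLinearMap f)
  rw [setAverage_eq, hv, ← e] at this
  exact this

theorem one_sub_sq_mul_cfc_lowSymbol {R : H →L[ℂ] H} (hR : IsSelfAdjoint R) :
    (1 - R) ^ 2 * cfc (lowSymbol 1) R = R * cfc (bandSymbol 1) R := by
  have hl := continuous_lowSymbol one_pos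
  have hb := continuous_bandSymbol one_pos
  have h2 : (1 - R) ^ 2 = cfc (fun t : ℝ => (1 - t) ^ 2) R := by
    rw [cfc_pow (fun t : ℝ => 1 - t) 2 R, cfc_sub (fun _ => 1) (fun t : ℝ => t) R, cfc_id' ℝ R,
      cfc_const_one ℝ R]
  have h1 : R * cfc (bandSymbol 1) R = cfc (fun t => t * bandSymbol 1 t) R := by
    rw [cfc_mul (fun t => t) (bandSymbol 1) R (by fun_prop) hb.continuousOn, cfc_id' ℝ R]
  rw [h2, h1, ← cfc_mul _ _ _ (by fun_prop) hl.continuousOn]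
  congr 1
  funext t
  by_cases ht : 0 < t
  · simp only [lowSymbol, bandSymbol, ht, if_true, one_mul]
    field_simp
    ring
  · simp [lowSymbol, bandSymbol, ht]

/-- Partial sums of `(1 - R)⁻² = ∑ (n+1) Rⁿ`, with the remainder explicit. -/
theorem sum_succ_mul_pow_mul_one_sub_sq {A : Type*} [Ring A] (R : A) (N : ℕ) :
    (∑ n ∈ Finset.range N, (n + 1 : A) * R ^ n) * (1 - R) ^ 2
      = 1 - ((N + 1 : A) * R ^ N - (N : A) * R ^ (N + 1)) := by
  induction N with
  | zero => simp
  | succ N ih =>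
    rw [Finset.sum_range_succ, add_mul, ih]
    push_cast
    have : R ^ N * (1 - R) ^ 2 = R ^ N - 2 * R ^ (N + 1) + R ^ (N + 1 + 1) := by
      have e : (1 - R) ^ 2 = 1 - 2 * R + R * R := by noncomm_ring
      rw [e, mul_add, mul_sub, mul_one, pow_succ, pow_succ, two_mul, two_mul, mul_add,
        ← mul_assoc (R ^ N) R R, pow_succ R N]
    rw [mul_assoc, this]
    noncomm_ring

/-- `(1 - A) A⁻² g = ∑ (n + 1) R^{n+1} g`, `R = (1 - A)⁻¹`, for `g = A² e^A f`. -/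
theorem tendsto_sum_pow_apply {R : H →L[ℂ] H} (hR : IsSelfAdjoint R) (hn : ‖R‖ ≤ 1 / 2) (f : H) :
    Filter.Tendsto (fun N : ℕ => ∑ n ∈ Finset.range N,
        ((n : ℝ) + 1) • (R ^ (n + 1)) (bandPart R 1 f))
      Filter.atTop (nhds (lowPart R 1 f)) := by
  unfold lowPart bandPart
  have hpow : ∀ N : ℕ, ‖R ^ N‖ ≤ (1 / 2) ^ N := by
    intro N
    induction N with
    | zero => rw [pow_zero, pow_zero]; exact ContinuousLinearMap.norm_id_le
    | succ N ih =>
      rw [pow_succ, pow_succ]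
      exact (norm_mul_le _ _).trans (mul_le_mul ih hn (norm_nonneg _) (by positivity))
  set l := cfc (lowSymbol 1) R f with hl
  -- Substituting `R A² e^A = (1 - R)² (1 - A) e^A` lets the factor `(1 - R)²` cancel against the
  -- partial sums, with no inverse of `A` needed.
  have e : ∀ N : ℕ, ∑ n ∈ Finset.range N, ((n : ℝ) + 1) • (R ^ (n + 1)) (cfc (bandSymbol 1) R f)
      = l - (((N : ℝ) + 1) • (R ^ N) l - (N : ℝ) • (R ^ (N + 1)) l) := by
    intro N
    have h1 := congrArg (fun T => (T * cfc (lowSymbol 1) R) f)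
      (sum_succ_mul_pow_mul_one_sub_sq R N)
    have h3 : ∀ (n : ℕ) (T : H →L[ℂ] H) (x : H), ((n : H →L[ℂ] H) * T) x = (n : ℝ) • T x := by
      intro n T x
      rw [← nsmul_eq_mul, smul_apply, Nat.cast_smul_eq_nsmul]
    simp only [mul_assoc, one_sub_sq_mul_cfc_lowSymbol hR, ← Nat.cast_succ, sub_mul, Finset.sum_mul,
      one_mul, sum_apply, sub_apply, h3] at h1
    simp only [← Nat.cast_succ, pow_succ]
    exact h1
  simp only [e]
  have hz : Filter.Tendsto (fun N : ℕ => ((N : ℝ) + 1) • (R ^ N) l - (N : ℝ) • (R ^ (N + 1)) l)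
      Filter.atTop (nhds 0) := by
    have hg : Filter.Tendsto (fun N : ℕ => (2 * (N : ℝ) + 1) * (1 / 2) ^ N * ‖l‖)
        Filter.atTop (nhds 0) := by
      have t1 := tendsto_self_mul_const_pow_of_lt_one (r := (1 / 2 : ℝ)) (by norm_num) (by norm_num)
      have t2 := tendsto_pow_atTop_nhds_zero_of_lt_one (r := (1 / 2 : ℝ)) (by norm_num) (by norm_num)
      have := ((t1.const_mul 2).add t2).mul_const ‖l‖
      simp only [mul_zero, add_zero, zero_mul] at this
      refine this.congr fun N => ?_
      ring
    refine squeeze_zero_norm (fun N => ?_) hg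
    have b1 : ‖(R ^ N) l‖ ≤ (1 / 2) ^ N * ‖l‖ := (R ^ N).le_of_opNorm_le (hpow N) l
    have b2 : ‖(R ^ (N + 1)) l‖ ≤ (1 / 2) ^ N * ‖l‖ :=
      ((R ^ (N + 1)).le_of_opNorm_le (hpow (N + 1)) l).trans (by
        gcongr ?_ * _
        exact pow_le_pow_of_le_one (by norm_num) (by norm_num) N.le_succ)
    refine (norm_sub_le _ _).trans ?_
    rw [norm_smul, norm_smul, Real.norm_of_nonneg (by positivity), Real.norm_of_nonneg (by positivity)]
    calc _ ≤ ((N : ℝ) + 1) * ((1 / 2) ^ N * ‖l‖) + N * ((1 / 2) ^ N * ‖l‖) := by gcongr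
      _ = _ := by ring
  simpa using tendsto_const_nhds.sub hz

end Spectral

/-! ### The spectral gap. -/

theorem norm_inclusion_apply_sq_le {d : ℕ} (hd : 3 ≤ d) (u : H1 d) :
    ‖inclusion d u‖ ^ 2 ≤ 1 / 2 * ‖u‖ ^ 2 := by
  have h1 : ‖u‖ ^ 2 = ‖u.1.fst‖ ^ 2 + ‖u.1.snd‖ ^ 2 := WithLp.prod_norm_sq_eq_of_L2 u.1
  have h2 : ‖u.1.fst‖ ^ 2 ≤ ‖u.1.snd‖ ^ 2 := by
    gcongr
    exact norm_fst_le_norm_snd hd u.2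
  change ‖u.1.fst‖ ^ 2 ≤ _
  linarith

theorem norm_resolvent_le {d : ℕ} (hd : 3 ≤ d) : ‖resolvent d‖ ≤ 1 / 2 := by
  have h1 : ‖inclusion d‖ ≤ √(1 / 2) := by
    refine ContinuousLinearMap.opNorm_le_bound _ (Real.sqrt_nonneg _) fun u => ?_
    refine le_of_sq_le_sq ?_ (by positivity)
    rw [mul_pow, Real.sq_sqrt (by norm_num)]
    exact norm_inclusion_apply_sq_le hd u
  calc ‖resolvent d‖ ≤ ‖inclusion d‖ * ‖(inclusion d).adjoint‖ :=
        ContinuousLinearMap.opNorm_comp_le _ _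
    _ = ‖inclusion d‖ * ‖inclusion d‖ := by rw [LinearIsometryEquiv.norm_map]
    _ ≤ √(1 / 2) * √(1 / 2) := by gcongr
    _ = 1 / 2 := Real.mul_self_sqrt (by norm_num)

theorem spectrum_resolvent_subset {d : ℕ} (hd : 3 ≤ d) :
    spectrum ℝ (resolvent d) ⊆ Set.Icc 0 (1 / 2) :=
  spectrum_comp_adjoint_subset (inclusion d) (norm_resolvent_le hd)

/-! ### Interpolation and decomposition estimates in `L^p`. -/

section Lp

variable {α : Type*} {m : MeasurableSpace α} {μ : Measure α}

theorem convex_ae_norm_le (D : ℝ) :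
    Convex ℝ {h : Lp ℂ 2 μ | ∀ᵐ x ∂μ, h x ∈ Metric.closedBall (0 : ℂ) D} := by
  intro g hg h hh a b ha hb hab
  filter_upwards [hg, hh, Lp.coeFn_add (a • g) (b • h), Lp.coeFn_smul a g, Lp.coeFn_smul b h]
    with x h1 h2 h3 h4 h5
  rw [h3, Pi.add_apply, h4, h5]
  exact convex_closedBall (0 : ℂ) D h1 h2 ha hb hab

/-- Fatou's lemma along an almost everywhere convergent subsequence. -/
theorem isClosed_eLpNorm_le (p B : ℝ≥0∞) :
    IsClosed {h : Lp ℂ 2 μ | eLpNorm h p μ ≤ B} := by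
  refine IsSeqClosed.isClosed fun u h hu hh => ?_
  obtain ⟨ns, -, hns⟩ := (tendstoInMeasure_of_tendsto_Lp hh).exists_seq_tendsto_ae
  refine (Lp.eLpNorm_lim_le_liminf_eLpNorm
    (fun n => (Lp.aestronglyMeasurable (u (ns n)))) h hns).trans ?_
  exact Filter.liminf_le_of_le (by isBoundedDefault) fun b hb => by
    obtain ⟨n, hn⟩ := hb.exists
    exact hn.trans (hu _)

theorem lintegral_enorm_sq_eq (h : Lp ℂ 2 μ) :
    ∫⁻ x, ENNReal.ofReal (‖h x‖ ^ 2) ∂μ = ENNReal.ofReal (‖h‖ ^ 2) := by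
  rw [norm_sq_eq_integral_of_ae h (Filter.EventuallyEq.refl _ _),
    ofReal_integral_eq_lintegral_ofReal]
  · exact (memLp_two_iff_integrable_sq_norm (Lp.aestronglyMeasurable h)).1 (Lp.memLp h)
  · exact Filter.Eventually.of_forall fun x => by positivity

theorem eLpNorm_le_of_lintegral_le {h : α → ℂ} {p B : ℝ} (hp : 0 < p) (hB : 0 ≤ B)
    (hle : ∫⁻ x, ENNReal.ofReal (‖h x‖ ^ p) ∂μ ≤ ENNReal.ofReal B) :
    eLpNorm h (ENNReal.ofReal p) μ ≤ ENNReal.ofReal (B ^ (1 / p)) := by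
  rw [eLpNorm_eq_lintegral_rpow_enorm_toReal (by simpa using hp) (by simp),
    ENNReal.toReal_ofReal hp.le, ← ENNReal.ofReal_rpow_of_nonneg hB (by positivity)]
  gcongr
  refine le_trans (le_of_eq (lintegral_congr fun x => ?_)) hle
  rw [← ENNReal.ofReal_rpow_of_nonneg (norm_nonneg _) hp.le, ofReal_norm]

theorem eLpNorm_le_of_ae_norm_le {h : Lp ℂ 2 μ} {p D : ℝ} (hp : 2 ≤ p) (hD : 0 ≤ D)
    (hb : ∀ᵐ x ∂μ, ‖h x‖ ≤ D) :
    eLpNorm h (ENNReal.ofReal p) μ ≤ ENNReal.ofReal (D ^ (1 - 2 / p) * ‖h‖ ^ (2 / p)) := by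
  have hp0 : 0 < p := by linarith
  have e : D ^ (1 - 2 / p) * ‖h‖ ^ (2 / p) = (D ^ (p - 2) * ‖h‖ ^ 2) ^ (1 / p) := by
    rw [Real.mul_rpow (by positivity) (by positivity), ← Real.rpow_mul hD, ← Real.rpow_natCast,
      ← Real.rpow_mul (norm_nonneg _)]
    congr 2 <;> field_simp
    norm_num
  rw [e]
  refine eLpNorm_le_of_lintegral_le hp0 (by positivity) ?_
  rw [ENNReal.ofReal_mul (by positivity), ← lintegral_enorm_sq_eq,
    ← lintegral_const_mul' _ _ ENNReal.ofReal_ne_top]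
  refine lintegral_mono_ae (hb.mono fun x hx => ?_)
  rw [← ENNReal.ofReal_mul (by positivity)]
  refine ENNReal.ofReal_le_ofReal ?_
  calc ‖h x‖ ^ p = ‖h x‖ ^ (p - 2) * ‖h x‖ ^ 2 := by
        rw [← Real.rpow_natCast, ← Real.rpow_add_of_nonneg (norm_nonneg _) (by linarith) (by norm_num)]
        norm_num
    _ ≤ _ := by gcongr

/-- At the right scale the remainder is at most half of `|h|`, so `|h| ≤ 2|r_k|` handles two of the
`p` powers, and the choice of scale handles the other `p - 2`, since `q^{p-2} = 4` turns
`q^{k(p-2)}` into `4^k`. -/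
theorem norm_rpow_le_of_decomposition {q K p : ℝ} (hq : 1 < q) (hK : 0 < K) (hp : 2 ≤ p)
    (hqp : q ^ (p - 2) = 4) {h : ℂ} {r : ℕ → ℂ} (h0 : r 0 = h)
    (hr : ∀ k, ‖h - r k‖ ≤ K * q ^ k) :
    ∃ k, ‖h‖ ^ p ≤ 16 * (2 * K) ^ (p - 2) * (4 ^ k * ‖r k‖ ^ 2) := by
  have e : ‖h‖ ^ p = ‖h‖ ^ (p - 2) * ‖h‖ ^ 2 := by
    rw [← Real.rpow_natCast, ← Real.rpow_add_of_nonneg (norm_nonneg _) (by linarith) (by norm_num)]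
    norm_num
  have hp2 : 0 ≤ p - 2 := by linarith
  have hK2 : 0 ≤ (2 * K) ^ (p - 2) := by positivity
  rcases lt_or_ge ‖h‖ (2 * K) with hlt | hge
  · refine ⟨0, ?_⟩
    rw [e, h0]
    calc ‖h‖ ^ (p - 2) * ‖h‖ ^ 2 ≤ (2 * K) ^ (p - 2) * ‖h‖ ^ 2 := by gcongr
      _ ≤ 16 * ((2 * K) ^ (p - 2) * ‖h‖ ^ 2) := by
        have : 0 ≤ (2 * K) ^ (p - 2) * ‖h‖ ^ 2 := by positivity
        linarith
      _ = _ := by ring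
  -- Here `q^k ≤ |h|/(2K) < q^{k+1}`: the first bound gives `|h - r_k| ≤ |h|/2`, the second bounds
  -- `|h|^{p-2}`. When `|h| < 2K` no such `k` exists, and `r 0 = h` was used instead.
  · obtain ⟨k, hk1, hk2⟩ := exists_nat_pow_near (x := ‖h‖ / (2 * K)) (y := q)
      ((one_le_div (by positivity)).2 hge) hq
    rw [le_div_iff₀ (by positivity)] at hk1
    rw [div_lt_iff₀ (by positivity)] at hk2
    refine ⟨k, ?_⟩
    have h1 : ‖h‖ ≤ 2 * ‖r k‖ := by
      have a1 := norm_add_le (h - r k) (r k)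
      rw [sub_add_cancel] at a1
      have a2 := hr k
      linarith
    have h2 : (q ^ (k + 1) * (2 * K)) ^ (p - 2) = 4 ^ (k + 1) * (2 * K) ^ (p - 2) := by
      rw [Real.mul_rpow (by positivity) (by positivity), ← Real.rpow_natCast,
        ← Real.rpow_mul (by positivity), mul_comm ((k + 1 : ℕ) : ℝ), Real.rpow_mul (by positivity),
        hqp, Real.rpow_natCast]
    rw [e]
    calc ‖h‖ ^ (p - 2) * ‖h‖ ^ 2 ≤ (q ^ (k + 1) * (2 * K)) ^ (p - 2) * (2 * ‖r k‖) ^ 2 := by gcongr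
      _ = _ := by rw [h2]; ring

/-- The index `k` depends on the point, so the pointwise bound is weakened to the sum over all `k`
before integrating. -/
theorem eLpNorm_le_of_decomposition {q K p B : ℝ} (hq : 1 < q) (hK : 0 < K) (hp : 2 ≤ p)
    (hqp : q ^ (p - 2) = 4) (hB : 0 ≤ B) {h : Lp ℂ 2 μ} {r : ℕ → Lp ℂ 2 μ} (h0 : r 0 = h)
    (hr : ∀ k, ∀ᵐ x ∂μ, (h - r k) x ∈ Metric.closedBall (0 : ℂ) (K * q ^ k))
    (hsum : ∀ N, ∑ k ∈ Finset.range N, 4 ^ k * ‖r k‖ ^ 2 ≤ B) :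
    eLpNorm h (ENNReal.ofReal p) μ ≤ ENNReal.ofReal ((16 * (2 * K) ^ (p - 2) * B) ^ (1 / p)) := by
  refine eLpNorm_le_of_lintegral_le (by linarith) (by positivity) ?_
  have hpt : ∀ᵐ x ∂μ, ENNReal.ofReal (‖h x‖ ^ p) ≤ ∑' k : ℕ,
      ENNReal.ofReal (16 * (2 * K) ^ (p - 2) * 4 ^ k) * ENNReal.ofReal (‖r k x‖ ^ 2) := by
    have hsub : ∀ᵐ x ∂μ, ∀ k, (h - r k) x = h x - r k x :=
      ae_all_iff.2 fun k => Lp.coeFn_sub h (r k)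
    filter_upwards [ae_all_iff.2 hr, hsub] with x h1 h2
    obtain ⟨k, hk⟩ := norm_rpow_le_of_decomposition (h := h x) (r := fun k => r k x) hq hK hp hqp
      (by simp only [h0]) (fun k => by
        have := h1 k
        rwa [h2, mem_closedBall_zero_iff] at this)
    refine le_trans ?_ (ENNReal.le_tsum k)
    rw [← ENNReal.ofReal_mul (by positivity)]
    exact ENNReal.ofReal_le_ofReal (hk.trans (le_of_eq (by ring)))
  refine (lintegral_mono_ae hpt).trans ?_
  rw [lintegral_tsum]
  · simp only [lintegral_const_mul' _ _ ENNReal.ofReal_ne_top, lintegral_enorm_sq_eq]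
    refine ENNReal.tsum_le_of_sum_range_le fun N => ?_
    have : ∀ k, 0 ≤ 16 * (2 * K) ^ (p - 2) * 4 ^ k * ‖r k‖ ^ 2 := fun k => by positivity
    have e : ∀ k, ENNReal.ofReal (16 * (2 * K) ^ (p - 2) * 4 ^ k) * ENNReal.ofReal (‖r k‖ ^ 2)
        = ENNReal.ofReal (16 * (2 * K) ^ (p - 2) * 4 ^ k * ‖r k‖ ^ 2) := fun k =>
      (ENNReal.ofReal_mul (by positivity)).symm
    simp only [e]
    rw [← ENNReal.ofReal_sum_of_nonneg fun k _ => this k]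
    refine ENNReal.ofReal_le_ofReal ?_
    calc _ = 16 * (2 * K) ^ (p - 2) * ∑ k ∈ Finset.range N, 4 ^ k * ‖r k‖ ^ 2 := by
          rw [Finset.mul_sum]
          exact Finset.sum_congr rfl fun k _ => by ring
      _ ≤ _ := by
          have := hsum N
          gcongr
  · intro k
    have := (Lp.aestronglyMeasurable (r k)).norm.aemeasurable
    fun_prop

end Lp

/-! ### The low frequencies. -/

theorem resolvent_pow_mem_box {d : ℕ} {g : L2 d} {M : ℝ} (hM : 0 < M)
    (hg : ∀ᵐ p ∂vol d, g p ∈ box M) (n : ℕ) : ∀ᵐ p ∂vol d, (resolvent d ^ n) g p ∈ box M := by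
  induction n with
  | zero => simpa using hg
  | succ n ih =>
    rw [pow_succ']
    exact resolvent_mem_box hM ih

theorem norm_resolvent_pow_apply_le {d : ℕ} (hd : 3 ≤ d) (g : L2 d) (n : ℕ) :
    ‖(resolvent d ^ n) g‖ ≤ (1 / 2) ^ n * ‖g‖ := by
  induction n with
  | zero => simp
  | succ n ih =>
    rw [pow_succ', pow_succ']
    change ‖resolvent d ((resolvent d ^ n) g)‖ ≤ _
    refine ((resolvent d).le_of_opNorm_le (norm_resolvent_le hd) _).trans ?_
    rw [mul_assoc]
    gcongr

/-- The `L^p` bound for the low frequencies, from the spectral gap and the maximum principle. -/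
theorem exists_eLpNorm_lowSymbol_le {d : ℕ} (hd : 3 ≤ d) {p : ℝ} (hp : 2 ≤ p) :
    ∃ C : ℝ, 0 < C ∧ ∀ (f : L2 d) (A : ℝ), 0 < A →
      (∀ᵐ x ∂vol d, bandPart (resolvent d) 1 f x ∈ Metric.closedBall (0 : ℂ) A) →
      eLpNorm (lowPart (resolvent d) 1 f) (ENNReal.ofReal p) (vol d)
        ≤ ENNReal.ofReal (C * (‖f‖ ^ (2 / p) * A ^ (1 - 2 / p))) := by
  have hp0 : 0 < p := by linarith
  have hθ : 0 < 2 / p := by positivity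
  have hθ1 : 0 ≤ 1 - 2 / p := by
    rw [sub_nonneg, div_le_one hp0]; exact hp
  -- The `L²` decay rate `1/2` of the powers of the resolvent, after interpolation with a bounded
  -- `L^∞` norm.
  set ρ : ℝ := (1 / 2) ^ (2 / p) with hρ
  have hρ0 : 0 < ρ := by positivity
  have hρ1 : ρ < 1 := Real.rpow_lt_one (by norm_num) (by norm_num) hθ
  have hsum : Summable fun n : ℕ => ((n : ℝ) + 1) * ρ ^ n := by
    have h1 := summable_pow_mul_geometric_of_norm_lt_one 1 (r := ρ) (by
      rwa [Real.norm_of_nonneg hρ0.le])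
    have h2 := summable_geometric_of_lt_one hρ0.le hρ1
    refine (h1.add h2).congr fun n => ?_
    ring
  set S := ∑' n : ℕ, ((n : ℝ) + 1) * ρ ^ n with hS
  have hS1 : 0 ≤ S := tsum_nonneg fun n => by positivity
  set c : ℝ := 2 ^ (2 / p) * 2 ^ (1 - 2 / p) with hc
  have hc0 : 0 < c := by positivity
  refine ⟨(S + 1) * c, by positivity, fun f A hA hf => ?_⟩
  set g := bandPart (resolvent d) 1 f with hg
  have hgn : ‖g‖ ≤ 2 * ‖f‖ := by
    exact ContinuousLinearMap.le_of_opNorm_le _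
      (norm_bandPart_one_le (spectrum_resolvent_subset hd)) f
  have hbox : ∀ᵐ x ∂vol d, g x ∈ box A :=
    hf.mono fun x hx => mem_box_of_norm_le (by simpa using hx)
  have hterm : ∀ n : ℕ, eLpNorm ((resolvent d ^ (n + 1)) g) (ENNReal.ofReal p) (vol d)
      ≤ ENNReal.ofReal (ρ ^ n * (c * (‖f‖ ^ (2 / p) * A ^ (1 - 2 / p)))) := by
    intro n
    refine (eLpNorm_le_of_ae_norm_le hp (D := 2 * A) (by positivity)
      ((resolvent_pow_mem_box hA hbox (n + 1)).mono fun x hx => norm_le_of_mem_box hx)).trans ?_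
    refine ENNReal.ofReal_le_ofReal ?_
    have h1 : ‖(resolvent d ^ (n + 1)) g‖ ≤ (1 / 2) ^ n * (2 * ‖f‖) := by
      refine (norm_resolvent_pow_apply_le hd g (n + 1)).trans ?_
      gcongr ?_ * ?_
      · exact pow_le_pow_of_le_one (by norm_num) (by norm_num) n.le_succ
    have h2 : ((1 / 2 : ℝ) ^ n) ^ (2 / p) = ρ ^ n := by
      rw [← Real.rpow_natCast, ← Real.rpow_mul (by norm_num), mul_comm,
        Real.rpow_mul (by norm_num), Real.rpow_natCast]
    calc (2 * A) ^ (1 - 2 / p) * ‖(resolvent d ^ (n + 1)) g‖ ^ (2 / p)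
        ≤ (2 * A) ^ (1 - 2 / p) * ((1 / 2) ^ n * (2 * ‖f‖)) ^ (2 / p) := by gcongr
      _ = _ := by
        rw [Real.mul_rpow (by norm_num) hA.le, Real.mul_rpow (by positivity) (by positivity),
          Real.mul_rpow (by norm_num) (norm_nonneg _), h2, hc]
        ring
  have hcl := isClosed_eLpNorm_le (μ := vol d) (ENNReal.ofReal p)
    (ENNReal.ofReal ((S + 1) * c * (‖f‖ ^ (2 / p) * A ^ (1 - 2 / p))))
  refine hcl.mem_of_tendsto (tendsto_sum_pow_apply (resolvent_isSelfAdjoint d)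
    (norm_resolvent_le hd) f) (Filter.Eventually.of_forall fun N => ?_)
  have hp1 : 1 ≤ ENNReal.ofReal p := by
    rw [← ENNReal.ofReal_one]; exact ENNReal.ofReal_le_ofReal (by linarith)
  have hcoe : ∀ N : ℕ, eLpNorm (↑(∑ n ∈ Finset.range N, ((n : ℝ) + 1) • (resolvent d ^ (n + 1)) g) :
      Hyp d → ℂ) (ENNReal.ofReal p) (vol d) ≤ ∑ n ∈ Finset.range N,
        ENNReal.ofReal ((((n : ℝ) + 1) * ρ ^ n) * (c * (‖f‖ ^ (2 / p) * A ^ (1 - 2 / p)))) := by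
    intro N
    induction N with
    | zero =>
      simp only [Finset.range_zero, Finset.sum_empty]
      rw [eLpNorm_congr_ae (Lp.coeFn_zero ℂ 2 (vol d))]
      simp
    | succ N ih =>
      rw [Finset.sum_range_succ, Finset.sum_range_succ, eLpNorm_congr_ae (Lp.coeFn_add _ _)]
      refine (eLpNorm_add_le (Lp.aestronglyMeasurable _) (Lp.aestronglyMeasurable _) hp1).trans ?_
      refine add_le_add ih ?_
      rw [eLpNorm_congr_ae (Lp.coeFn_smul _ _), eLpNorm_const_smul, mul_assoc,
        ENNReal.ofReal_mul (by positivity), Real.enorm_of_nonneg (by positivity)]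
      gcongr
      exact hterm N
  refine (hcoe N).trans ?_
  rw [← ENNReal.ofReal_sum_of_nonneg fun n _ => by positivity, ← Finset.sum_mul]
  refine ENNReal.ofReal_le_ofReal ?_
  rw [mul_assoc (S + 1)]
  gcongr
  have := hsum.sum_le_tsum (Finset.range N) fun n _ => by positivity
  linarith

/-! ### The high frequencies. -/

theorem ae_norm_bandPart_le {d : ℕ} {f : L2 d} {l D : ℝ} (hl : 1 ≤ l)
    (h : ∀ᵐ x ∂vol d, ‖littlewoodPaley d l f x‖ ≤ D) :
    ∀ᵐ x ∂vol d, ‖bandPart (resolvent d) (l ^ 2)⁻¹ f x‖ ≤ l ^ 2 / 2 * D := by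
  have hl0 : 0 < l := by linarith
  have e : littlewoodPaley d l f = (2 * (l ^ 2)⁻¹) • bandPart (resolvent d) (l ^ 2)⁻¹ f :=
    congrArg (fun T => T f) (functionOfGenerator_eq_bandPart (resolvent d) hl0)
  filter_upwards [h, Lp.coeFn_smul (2 * (l ^ 2)⁻¹) (bandPart (resolvent d) (l ^ 2)⁻¹ f)]
    with x h1 h2
  rw [e, h2, Pi.smul_apply, norm_smul, Real.norm_of_nonneg (by positivity)] at h1
  calc _ = l ^ 2 / 2 * (2 * (l ^ 2)⁻¹ * ‖bandPart (resolvent d) (l ^ 2)⁻¹ f x‖) := by field_simp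
    _ ≤ _ := by gcongr

/-- For `s = l⁻²` in `[4^{-(k+1)}, 4^{-k}]` one has `1 ≤ l ≤ 2^{k+1}`, so the band operator is
bounded by `4^{k+1} A q^{k+1}/2`. The interval has length `3 · 4^{-(k+1)}`, which leaves `(3/2) A
q^{k+1}`. -/
theorem ae_norm_lowPart_sub_le {d : ℕ} (hd : 3 ≤ d) {β q : ℝ} (hβ : 0 < β) (hq : q = 2 ^ β)
    {f : L2 d} {A : ℝ} (hA : 0 < A)
    (h : ∀ l : ℝ, 1 ≤ l → ∀ᵐ x ∂vol d, ‖littlewoodPaley d l f x‖ ≤ A * l ^ β) (k : ℕ) :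
    ∀ᵐ x ∂vol d, ‖(lowPart (resolvent d) (4 ^ (k + 1))⁻¹ f - lowPart (resolvent d) (4 ^ k)⁻¹ f) x‖
      ≤ 2 * A * q ^ (k + 1) := by
  have h4 : ((4 : ℝ) ^ (k + 1))⁻¹ < (4 ^ k)⁻¹ :=
    inv_strictAnti₀ (by positivity) (pow_lt_pow_right₀ (by norm_num) k.lt_succ_self)
  set D : ℝ := 4 ^ (k + 1) / 2 * (A * q ^ (k + 1)) with hD
  have hband : ∀ s ∈ Set.Icc ((4 : ℝ) ^ (k + 1))⁻¹ (4 ^ k)⁻¹, bandPart (resolvent d) s f ∈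
      {h : L2 d | ∀ᵐ x ∂vol d, h x ∈ Metric.closedBall (0 : ℂ) D} := by
    intro s hs
    have hs0 : 0 < s := lt_of_lt_of_le (by positivity) hs.1
    have hs1 : s ≤ 1 := hs.2.trans (inv_le_one_of_one_le₀ (one_le_pow₀ (by norm_num)))
    set l := √(s⁻¹) with hl
    have hl2 : l ^ 2 = s⁻¹ := Real.sq_sqrt (by positivity)
    have hl1 : 1 ≤ l := Real.one_le_sqrt.2 ((one_le_inv₀ hs0).2 hs1)
    have hle : s⁻¹ ≤ 4 ^ (k + 1) := inv_le_of_inv_le₀ (by positivity) hs.1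
    have hl3 : l ≤ 2 ^ (k + 1) := by
      refine le_of_sq_le_sq ?_ (by positivity)
      rw [hl2, ← pow_mul, mul_comm, pow_mul]
      norm_num
      exact hle
    have hl4 : l ^ β ≤ q ^ (k + 1) := by
      refine (Real.rpow_le_rpow (by positivity) hl3 hβ.le).trans (le_of_eq ?_)
      rw [hq, ← Real.rpow_natCast, ← Real.rpow_natCast, ← Real.rpow_mul (by norm_num),
        ← Real.rpow_mul (by norm_num), mul_comm]
    have := ae_norm_bandPart_le hl1 (h l hl1)
    rw [hl2, inv_inv] at this
    filter_upwards [this] with x hx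
    rw [mem_closedBall_zero_iff]
    refine hx.trans ?_
    rw [hD]
    gcongr
  have hmem := lowPart_sub_apply_mem (resolvent_isSelfAdjoint d) (spectrum_resolvent_subset hd)
    (by positivity) h4 (convex_ae_norm_le D) (isClosed_ae_mem Metric.isClosed_closedBall) hband
  filter_upwards [hmem, Lp.coeFn_smul ((((4 : ℝ) ^ k)⁻¹ - (4 ^ (k + 1))⁻¹)⁻¹)
    (lowPart (resolvent d) (4 ^ (k + 1))⁻¹ f - lowPart (resolvent d) (4 ^ k)⁻¹ f)] with x h1 h2
  rw [mem_closedBall_zero_iff] at h1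
  replace h1 := (congrArg norm h2).symm.trans_le h1
  rw [Pi.smul_apply, norm_smul,
    Real.norm_of_nonneg (inv_nonneg.2 (sub_nonneg.2 h4.le)),
    inv_mul_le_iff₀ (sub_pos.2 h4)] at h1
  refine h1.trans ?_
  have e : (((4 : ℝ) ^ k)⁻¹ - (4 ^ (k + 1))⁻¹) * D = 3 / 2 * (A * q ^ (k + 1)) := by
    rw [hD, pow_succ]
    field_simp
    ring
  have hq0 : 0 < q := by rw [hq]; positivity
  rw [e]
  have : 0 < A * q ^ (k + 1) := by positivity
  linarith

/-- The dyadic increments grow geometrically with ratio `q > 1`, so their sum is comparable to the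
last one; `2q/(q - 1)` is the constant that closes the induction. -/
theorem ae_norm_lowPart_sub_lowPart_one_le {d : ℕ} (hd : 3 ≤ d) {β q : ℝ} (hβ : 0 < β)
    (hq : q = 2 ^ β) {f : L2 d} {A : ℝ} (hA : 0 < A)
    (h : ∀ l : ℝ, 1 ≤ l → ∀ᵐ x ∂vol d, ‖littlewoodPaley d l f x‖ ≤ A * l ^ β) (k : ℕ) :
    ∀ᵐ x ∂vol d, ‖(lowPart (resolvent d) (4 ^ k)⁻¹ f - lowPart (resolvent d) 1 f) x‖
      ≤ 2 * q / (q - 1) * A * q ^ k := by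
  have hq1 : 1 < q := by rw [hq]; exact Real.one_lt_rpow (by norm_num) hβ
  have hq2 : 0 < q - 1 := by linarith
  induction k with
  | zero =>
    simp only [pow_zero, inv_one, sub_self]
    filter_upwards [Lp.coeFn_zero ℂ 2 (vol d)] with x hx
    rw [hx]
    simp only [Pi.zero_apply, norm_zero]
    positivity
  | succ k ih =>
    have e : lowPart (resolvent d) (4 ^ (k + 1))⁻¹ f - lowPart (resolvent d) 1 f =
      (lowPart (resolvent d) (4 ^ (k + 1))⁻¹ f - lowPart (resolvent d) (4 ^ k)⁻¹ f) +
        (lowPart (resolvent d) (4 ^ k)⁻¹ f - lowPart (resolvent d) 1 f) := by abel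
    rw [e]
    filter_upwards [ih, ae_norm_lowPart_sub_le hd hβ hq hA h k, Lp.coeFn_add
      (lowPart (resolvent d) (4 ^ (k + 1))⁻¹ f - lowPart (resolvent d) (4 ^ k)⁻¹ f)
      (lowPart (resolvent d) (4 ^ k)⁻¹ f - lowPart (resolvent d) 1 f)] with x h1 h2 h3
    rw [h3, Pi.add_apply]
    refine (norm_add_le _ _).trans ((add_le_add h2 h1).trans (le_of_eq ?_))
    rw [pow_succ]
    field_simp
    ring

/-- The high frequencies are controlled in `L^p` by the Besov-type norm. -/
theorem exists_eLpNorm_sub_lowPart_le {d : ℕ} (hd : 3 ≤ d) {p β : ℝ} (hβ : 0 < β) (hp : 2 ≤ p)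
    (hpβ : β * (p - 2) = 2) :
    ∃ C : ℝ, 0 < C ∧ ∀ (u : H1 d) (A : ℝ), 0 < A →
      (∀ l : ℝ, 1 ≤ l → ∀ᵐ x ∂vol d, ‖littlewoodPaley d l (inclusion d u) x‖ ≤ A * l ^ β) →
      eLpNorm (inclusion d u - lowPart (resolvent d) 1 (inclusion d u) : L2 d)
        (ENNReal.ofReal p) (vol d) ≤ ENNReal.ofReal (C * (‖u‖ ^ (2 / p) * A ^ (1 - 2 / p))) := by
  have hp0 : 0 < p := by linarith
  set q : ℝ := 2 ^ β with hq
  have hq1 : 1 < q := Real.one_lt_rpow (by norm_num) hβ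
  have hq2 : 0 < q - 1 := by linarith
  have hqp : q ^ (p - 2) = 4 := by
    rw [hq, ← Real.rpow_mul (by norm_num), hpβ]
    norm_num
  set c : ℝ := 2 * q / (q - 1) with hc
  have hc0 : 0 < c := by positivity
  refine ⟨(16 * (2 * c) ^ (p - 2) * (10 / 3)) ^ (1 / p), by positivity, fun u A hA h => ?_⟩
  set f := inclusion d u with hf
  have hr : ∀ k : ℕ, ∀ᵐ x ∂vol d, ((f - lowPart (resolvent d) 1 f)
      - (f - lowPart (resolvent d) (4 ^ k)⁻¹ f)) x ∈ Metric.closedBall (0 : ℂ) (c * A * q ^ k) := by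
    intro k
    rw [sub_sub_sub_cancel_left]
    filter_upwards [ae_norm_lowPart_sub_lowPart_one_le hd hβ hq hA h k] with x hx
    simpa using hx
  refine (eLpNorm_le_of_decomposition hq1 (mul_pos hc0 hA) hp hqp
    (B := 10 / 3 * ‖u‖ ^ 2) (by positivity)
    (r := fun k => f - lowPart (resolvent d) (4 ^ k)⁻¹ f) (by simp) hr
    (fun N => sum_norm_sub_lowPart_sq_le (inclusion d) (spectrum_resolvent_subset hd) N u)).trans ?_
  refine ENNReal.ofReal_le_ofReal (le_of_eq ?_)
  have e1 : 16 * (2 * (c * A)) ^ (p - 2) * (10 / 3 * ‖u‖ ^ 2)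
      = (16 * (2 * c) ^ (p - 2) * (10 / 3)) * (‖u‖ ^ (2 : ℝ) * A ^ (p - 2)) := by
    rw [← mul_assoc 2 c A, Real.mul_rpow (by positivity) hA.le, Real.rpow_ofNat]
    ring
  have e2 : (‖u‖ ^ (2 : ℝ) * A ^ (p - 2)) ^ (1 / p) = ‖u‖ ^ (2 / p) * A ^ (1 - 2 / p) := by
    rw [Real.mul_rpow (by positivity) (by positivity), ← Real.rpow_mul (norm_nonneg _),
      ← Real.rpow_mul hA.le]
    congr 2 <;> field_simp
  rw [e1, Real.mul_rpow (by positivity) (by positivity), e2]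

/-! ### Combining the two parts, and the form with the supremum. -/

theorem HasGradient.exists_mem_H1 {d : ℕ} (hd : 3 ≤ d) {f : L2 d} {X : L2Field d}
    (h : HasGradient f X) : ‖f‖ ≤ ‖X‖ ∧ ∃ u : H1 d, inclusion d u = f ∧ ‖u‖ ≤ 2 * ‖X‖ := by
  have h1 := norm_fst_le_norm_snd hd h
  refine ⟨h1, ⟨_, h⟩, rfl, ?_⟩
  refine le_of_sq_le_sq ?_ (by positivity)
  have h2 : ‖(WithLp.toLp 2 (f, X) : Pairs d)‖ ^ 2 = ‖f‖ ^ 2 + ‖X‖ ^ 2 :=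
    WithLp.prod_norm_sq_eq_of_L2 _
  have h3 : ‖f‖ ^ 2 ≤ ‖X‖ ^ 2 := by gcongr; exact h1
  rw [Submodule.coe_norm, h2]
  nlinarith [sq_nonneg ‖X‖]

theorem exists_eLpNorm_le {d : ℕ} (hd : 3 ≤ d) :
    ∃ C : ℝ, 0 < C ∧ ∀ (f : L2 d) (X : L2Field d), HasGradient f X → ∀ A : ℝ, 0 < A →
      (∀ l : ℝ, 1 ≤ l → ∀ᵐ x ∂vol d,
        ‖littlewoodPaley d l f x‖ ≤ A * l ^ (((d : ℝ) - 2) / 2)) →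
      eLpNorm f (ENNReal.ofReal (2 * d / (d - 2))) (vol d) ≤
        ENNReal.ofReal (C * (‖X‖ ^ (((d : ℝ) - 2) / d) * A ^ (2 / (d : ℝ)))) := by
  have hd' : (3 : ℝ) ≤ d := by exact_mod_cast hd
  have hd2 : (0 : ℝ) < d - 2 := by linarith
  set p : ℝ := 2 * d / (d - 2) with hp
  have hp2 : 2 ≤ p := by rw [hp, le_div_iff₀ hd2]; linarith
  have e1 : 2 / p = ((d : ℝ) - 2) / d := by rw [hp]; field_simp
  have e2 : 1 - 2 / p = 2 / (d : ℝ) := by rw [e1]; field_simp; ring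
  have e3 : ((d : ℝ) - 2) / 2 * (p - 2) = 2 := by rw [hp]; field_simp; ring
  obtain ⟨C₁, hC₁, h₁⟩ := exists_eLpNorm_sub_lowPart_le hd (half_pos hd2) hp2 e3
  obtain ⟨C₂, hC₂, h₂⟩ := exists_eLpNorm_lowSymbol_le hd hp2
  rw [e2, e1] at h₁ h₂
  have hθ : 0 ≤ ((d : ℝ) - 2) / d := by positivity
  refine ⟨C₁ * 2 ^ (((d : ℝ) - 2) / d) + C₂, by positivity, fun f X hfX A hA h => ?_⟩
  obtain ⟨hPoinc, u, rfl, hu⟩ := hfX.exists_mem_H1 hd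
  have b1 := h₁ u A hA h
  have hband : ∀ᵐ x ∂vol d, bandPart (resolvent d) 1 (inclusion d u) x ∈ Metric.closedBall (0 : ℂ) A := by
    have := ae_norm_bandPart_le le_rfl (h 1 le_rfl)
    simp only [one_pow, inv_one, Real.one_rpow, mul_one] at this
    filter_upwards [this] with x hx
    rw [mem_closedBall_zero_iff]
    linarith
  have b2 := h₂ (inclusion d u) A hA hband
  set f := inclusion d u
  set L := lowPart (resolvent d) 1 f
  have e : f = (f - L) + L := (sub_add_cancel f L).symm
  have hp1 : 1 ≤ ENNReal.ofReal p := by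
    rw [← ENNReal.ofReal_one]; exact ENNReal.ofReal_le_ofReal (by linarith)
  have hsum : eLpNorm f (ENNReal.ofReal p) (vol d) ≤
      eLpNorm (f - L : L2 d) (ENNReal.ofReal p) (vol d) + eLpNorm L (ENNReal.ofReal p) (vol d) := by
    conv_lhs => rw [e]
    rw [eLpNorm_congr_ae (Lp.coeFn_add _ _)]
    exact eLpNorm_add_le (Lp.aestronglyMeasurable _) (Lp.aestronglyMeasurable _) hp1
  refine (hsum.trans (add_le_add b1 b2)).trans ?_
  rw [← ENNReal.ofReal_add (by positivity) (by positivity)]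
  refine ENNReal.ofReal_le_ofReal ?_
  have hA' : 0 ≤ A ^ (2 / (d : ℝ)) := by positivity
  calc _ ≤ C₁ * ((2 * ‖X‖) ^ (((d : ℝ) - 2) / d) * A ^ (2 / (d : ℝ)))
        + C₂ * (‖X‖ ^ (((d : ℝ) - 2) / d) * A ^ (2 / (d : ℝ))) := by gcongr
    _ = _ := by
      rw [Real.mul_rpow (by norm_num) (norm_nonneg _)]
      ring

end HypSpace

end

theorem lemma2p3 (d : ℕ) (hd : 3 ≤ d) :
    ∃ C : ℝ, 0 < C ∧ ∀ (f : HypSpace.L2 d) (X : HypSpace.L2Field d), HypSpace.HasGradient f X →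
      eLpNorm f (ENNReal.ofReal (2 * d / (d - 2))) (HypSpace.vol d) ≤
        ENNReal.ofReal C * eLpNorm X 2 (HypSpace.vol d) ^ (((d : ℝ) - 2) / d) *
          (⨆ (l : ℝ) (_ : 1 ≤ l), ENNReal.ofReal (l ^ (-(((d : ℝ) - 2) / 2))) *
            eLpNorm (HypSpace.littlewoodPaley d l f) ∞ (HypSpace.vol d)) ^ (2 / (d : ℝ)) := by
  obtain ⟨C, hC, h⟩ := HypSpace.exists_eLpNorm_le hd
  refine ⟨C, hC, fun f X hfX => ?_⟩
  have hd' : (3 : ℝ) ≤ d := by exact_mod_cast hd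
  have hd2 : (0 : ℝ) < d - 2 := by linarith
  have hθ : 0 < ((d : ℝ) - 2) / d := by positivity
  have hη : 0 < 2 / (d : ℝ) := by positivity
  set S : ℝ≥0∞ := ⨆ (l : ℝ) (_ : 1 ≤ l), ENNReal.ofReal (l ^ (-(((d : ℝ) - 2) / 2))) *
    eLpNorm (HypSpace.littlewoodPaley d l f) ∞ (HypSpace.vol d) with hS
  have hX : eLpNorm X 2 (HypSpace.vol d) = ENNReal.ofReal ‖X‖ := by
    rw [Lp.norm_def, ENNReal.ofReal_toReal (Lp.eLpNorm_ne_top X)]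
  rw [hX]
  -- The estimates require a strictly positive bound, while `S` may vanish; for finite `S` one
  -- applies this to `A = S + 1/(n+1)` and lets `n → ∞`.
  have key : ∀ A : ℝ, 0 < A → S ≤ ENNReal.ofReal A →
      eLpNorm f (ENNReal.ofReal (2 * d / (d - 2))) (HypSpace.vol d) ≤
        ENNReal.ofReal C * ENNReal.ofReal ‖X‖ ^ (((d : ℝ) - 2) / d) *
          ENNReal.ofReal A ^ (2 / (d : ℝ)) := by
    intro A hA hSA
    refine (h f X hfX A hA fun l hl => ?_).trans (le_of_eq ?_)
    · have hl0 : 0 < l := by linarith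
      have h1 : ENNReal.ofReal (l ^ (-(((d : ℝ) - 2) / 2))) *
          eLpNorm (HypSpace.littlewoodPaley d l f) ∞ (HypSpace.vol d) ≤ ENNReal.ofReal A :=
        le_trans (le_iSup₂ (f := fun (l : ℝ) (_ : 1 ≤ l) =>
          ENNReal.ofReal (l ^ (-(((d : ℝ) - 2) / 2))) *
            eLpNorm (HypSpace.littlewoodPaley d l f) ∞ (HypSpace.vol d)) l hl) hSA
      have h2 : ∀ᵐ x ∂HypSpace.vol d, ‖HypSpace.littlewoodPaley d l f x‖ₑ ≤
          eLpNorm (HypSpace.littlewoodPaley d l f) ∞ (HypSpace.vol d) := by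
        rw [eLpNorm_exponent_top]
        exact ae_le_eLpNormEssSup
      filter_upwards [h2] with x hx
      have h3 : ENNReal.ofReal (l ^ (-(((d : ℝ) - 2) / 2)) * ‖HypSpace.littlewoodPaley d l f x‖)
          ≤ ENNReal.ofReal A := by
        rw [ENNReal.ofReal_mul (by positivity), ofReal_norm]
        exact le_trans (by gcongr) h1
      have h4 := (ENNReal.ofReal_le_ofReal_iff hA.le).1 h3
      rwa [Real.rpow_neg hl0.le, inv_mul_le_iff₀ (by positivity), mul_comm] at h4
    · rw [ENNReal.ofReal_mul hC.le, ENNReal.ofReal_mul (by positivity),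
        ENNReal.ofReal_rpow_of_nonneg (norm_nonneg _) hθ.le,
        ENNReal.ofReal_rpow_of_nonneg hA.le hη.le, mul_assoc]
  rcases eq_or_ne S ⊤ with hS' | hS'
  -- If `S = ⊤` the right side is `⊤` unless `‖X‖ = 0`. In that case it is `0 * ⊤ = 0`, and the
  -- Poincaré inequality forces `f = 0`.
  · rcases eq_or_ne ‖X‖ 0 with hX0 | hX0
    · have hf : f = 0 :=
        norm_le_zero_iff.1 ((hfX.exists_mem_H1 hd).1.trans (le_of_eq hX0))
      rw [hf, eLpNorm_congr_ae (Lp.coeFn_zero ℂ 2 (HypSpace.vol d))]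
      simp
    · rw [hS', ENNReal.top_rpow_of_pos hη, ENNReal.mul_top]
      · exact le_top
      · have : 0 < ‖X‖ := lt_of_le_of_ne (norm_nonneg _) (Ne.symm hX0)
        rw [ENNReal.ofReal_rpow_of_nonneg (norm_nonneg _) hθ.le,
          ← ENNReal.ofReal_mul hC.le]
        exact (ENNReal.ofReal_pos.2 (by positivity)).ne'
  · have hfin : ENNReal.ofReal C * ENNReal.ofReal ‖X‖ ^ (((d : ℝ) - 2) / d) ≠ ⊤ :=
      ENNReal.mul_ne_top ENNReal.ofReal_ne_top
        (ENNReal.rpow_ne_top_of_nonneg hθ.le ENNReal.ofReal_ne_top)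
    have hlim : Filter.Tendsto (fun n : ℕ => ENNReal.ofReal C *
        ENNReal.ofReal ‖X‖ ^ (((d : ℝ) - 2) / d) *
          ENNReal.ofReal (S.toReal + 1 / ((n : ℝ) + 1)) ^ (2 / (d : ℝ))) Filter.atTop
        (nhds (ENNReal.ofReal C * ENNReal.ofReal ‖X‖ ^ (((d : ℝ) - 2) / d) *
          S ^ (2 / (d : ℝ)))) := by
      have h1 : Filter.Tendsto (fun n : ℕ => S.toReal + 1 / ((n : ℝ) + 1)) Filter.atTop
          (nhds (S.toReal + 0)) :=
        tendsto_const_nhds.add tendsto_one_div_add_atTop_nhds_zero_nat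
      have h2 := (ENNReal.continuous_ofReal.tendsto _).comp h1
      rw [add_zero, ENNReal.ofReal_toReal hS'] at h2
      exact ((ENNReal.continuous_const_mul hfin).tendsto _).comp
        ((ENNReal.continuous_rpow_const.tendsto _).comp h2)
    refine ge_of_tendsto' hlim fun n => key _ (by positivity) ?_
    conv_lhs => rw [← ENNReal.ofReal_toReal hS']
    refine ENNReal.ofReal_le_ofReal ?_
    have : 0 < 1 / ((n : ℝ) + 1) := by positivity
    linarith
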